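/- Let $\Omega\subset\mathbb R^2$ be a bounded, strictly convex open domain containing the origin (the center), whose boundary is a closed real-analytic curve, and let $\gamma:\mathbb S^1=\mathbb R/L\mathbb Z\to\partial\Omega$ be an (analytic, bijective) unit speed parametrization of $\partial\Omega$, where $L$ is the length of $\partial\Omega$. Define $$\Psi:\mathbb S^1\times\mathbb S^1\to\mathbb R,\qquad \Psi(\xi,\eta)=|\gamma(\xi)|+|\gamma(\eta)|+|\gamma(\eta)-\gamma(\xi)|,$$ and $\varphi:\mathbb S^1\to\mathbb R$, $\varphi(\xi)=\Psi(\xi,\xi')$, where $\xi'=\xi'(\xi)$ is the parameter such that the segment from $0$ to $\gamma(\xi)$ is elastically reflected at $\gamma(\xi)$ into the segment from $\gamma(\xi)$ to $\gamma(\xi')$. A critical point of $\Psi$ is a point where $\Psi$ is differentiable with $\nabla\Psi=0$; the index of an isolated critical point is the index of the vector field $\nabla\Psi$ there, i.e. the winding number of $\nabla\Psi$ along small positively oriented circles around the point. Two distinct critical points $(\xi,\eta)$ and $(\xi',\eta')$ are called geometrically distinct if $(\xi,\eta)\neq(\eta',\xi')$. Then exactly one of the following holds: (i) the map $\varphi$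 is constant (that is, the center is a focal point of $\Omega$); (ii) there exist two isolated, geometrically distinct critical points of $\Psi$, one of which is a (global) maximum point of $\Psi$ with index $+1$ and the other of which has negative index. -/

import Mathlib

open Set Filter Topology

noncomputable section

/-- The Euclidean plane. -/
abbrev Plane : Type := EuclideanSpace ℝ (Fin 2)

/-- `γ : ℝ / Lℤ → ℝ²` is a real-analytic unit speed parametrization of the boundary of `Ω`:
a bijection of `ℝ / Lℤ` onto `∂Ω` whose periodic lift to `ℝ` is real-analytic with velocity
of norm one (hence `∂Ω` is a closed real-analytic curve of length `L`). -/
structure IsAnalyticUnitSpeedParam (Ω : Set Plane) {L : ℝ} (γ : AddCircle L → Plane) : Prop where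
  analytic : AnalyticOnNhd ℝ (fun t : ℝ => γ (t : AddCircle L)) univ
  unit_speed : ∀ t : ℝ, ‖deriv (fun s : ℝ => γ (s : AddCircle L)) t‖ = 1
  injective : Function.Injective γ
  range_eq : range γ = frontier Ω

/-- The velocity `γ'(ξ)`. -/
def velocity {L : ℝ} (γ : AddCircle L → Plane) (ξ : AddCircle L) : Plane :=
  deriv (fun t : ℝ => γ (ξ + (t : AddCircle L))) 0

/-- The perimeter function `Ψ(ξ, η) = |γ(ξ)| + |γ(η)| + |γ(η) - γ(ξ)|` of the triangle with
vertices `0`, `γ(ξ)`, `γ(η)`. -/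
def Psi {L : ℝ} (γ : AddCircle L → Plane) (p : AddCircle L × AddCircle L) : ℝ :=
  ‖γ p.1‖ + ‖γ p.2‖ + ‖γ p.2 - γ p.1‖

/-- The segment from `0` to `γ(ξ)` is elastically reflected at `γ(ξ)` into the segment from `γ(ξ)`
to `γ(ξ')`: the vector `γ(ξ') - γ(ξ)` is a positive multiple of the mirror image of the incoming
direction `γ(ξ) - 0` in the tangent line at `γ(ξ)`. -/
def ReflectsTo {L : ℝ} (γ : AddCircle L → Plane) (ξ ξ' : AddCircle L) : Prop :=
  ∃ t : ℝ, 0 < t ∧ γ ξ' - γ ξ = t • (Submodule.span ℝ {velocity γ ξ}).reflection (γ ξ)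

open Classical in
/-- The parameter `ξ' = ξ'(ξ)` of the point where the reflected ray hits the boundary again. (When
`γ` parametrizes the smooth boundary of a bounded strictly convex domain containing `0`, there is
exactly one such parameter; the default value `ξ` is never used.) -/
def nextParam {L : ℝ} (γ : AddCircle L → Plane) (ξ : AddCircle L) : AddCircle L :=
  if h : ∃ ξ', ReflectsTo γ ξ ξ' then h.choose else ξ

/-- `φ(ξ) = Ψ(ξ, ξ')`, the length of the closed broken line `0, γ(ξ), γ(ξ'), 0`, where the segment
from `0` to `γ(ξ)` is elastically reflected into the segment from `γ(ξ)` to `γ(ξ')`. -/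
def phi {L : ℝ} (γ : AddCircle L → Plane) (ξ : AddCircle L) : ℝ :=
  Psi γ (ξ, nextParam γ ξ)

/-- A function `f` on the torus, read in the chart `z ↦ p + (Re z, Im z)` centred at `p`. -/
def inChart {L : ℝ} (f : AddCircle L × AddCircle L → ℝ) (p : AddCircle L × AddCircle L)
    (z : ℂ) : ℝ :=
  f (p.1 + ((z.re : ℝ) : AddCircle L), p.2 + ((z.im : ℝ) : AddCircle L))

/-- `p` is a critical point of `f`: `f` is differentiable at `p` with zero gradient. (The
perimeter function is not differentiable on the diagonal, so that its critical points all lie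
off the diagonal.) -/
def IsCriticalPt {L : ℝ} (f : AddCircle L × AddCircle L → ℝ)
    (p : AddCircle L × AddCircle L) : Prop :=
  HasGradientAt (inChart f p) 0 0

/-- `p` is an isolated critical point of `f`. -/
def IsIsolatedCriticalPt {L : ℝ} (f : AddCircle L × AddCircle L → ℝ)
    (p : AddCircle L × AddCircle L) : Prop :=
  IsCriticalPt f p ∧ ∀ᶠ q in 𝓝[≠] p, ¬ IsCriticalPt f q

/-- The planar vector field `V` has index `n` at the point `z₀`: on every sufficiently small circle
`z₀ + r e^{it}`, `0 ≤ t ≤ 2π`, it has no zeros and a continuous determination `θ` of its argument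
increases by `2πn`; that is, `V / |V|` has winding number `n` along the circle. -/
def HasVectorFieldIndex (V : ℂ → ℂ) (z₀ : ℂ) (n : ℤ) : Prop :=
  ∃ R : ℝ, 0 < R ∧ ∀ r ∈ Ioo 0 R, ∃ θ : ℝ → ℝ,
    ContinuousOn θ (Icc 0 (2 * Real.pi)) ∧
    (∀ t ∈ Icc 0 (2 * Real.pi), V (circleMap z₀ r t) ≠ 0 ∧
      V (circleMap z₀ r t) =
        (‖V (circleMap z₀ r t)‖ : ℂ) * Complex.exp ((θ t : ℂ) * Complex.I)) ∧
    θ (2 * Real.pi) - θ 0 = 2 * Real.pi * (n : ℝ)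

/-- The critical point `p` of `f` has index `n`: the gradient field `∇f` has index `n` at `p`. -/
def HasCriticalIndex {L : ℝ} (f : AddCircle L × AddCircle L → ℝ)
    (p : AddCircle L × AddCircle L) (n : ℤ) : Prop :=
  HasVectorFieldIndex (gradient (inChart f p)) 0 n

/-- Two distinct points `(ξ, η)`, `(ξ', η')` are geometrically distinct if `(ξ, η) ≠ (η', ξ')`. -/
def GeometricallyDistinct {L : ℝ} (p q : AddCircle L × AddCircle L) : Prop :=
  p ≠ q ∧ p ≠ (q.2, q.1)

end

open Set Filter Topology

open scoped ContDiff RealInnerProductSpace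

/-! Lift the curve to `c : ℝ → Plane` and write Ψ(x, y) for the perimeter: `perimeterDeriv c x y` is
∂₁Ψ(x, y) and, by symmetry, `perimeterDeriv c y x` is ∂₂Ψ(x, y). Strict convexity makes ∂₁∂₂Ψ > 0
off the diagonal, so y ↦ ∂₁Ψ(x, y) increases strictly on (x, x + L) from a negative to a positive
limit. Its only zero g(x) is where the ray reflected at c x lands; g is analytic and g(x + L) = g(x)
+ L.

Hence the critical points of Ψ are the points (x, g x) at which the residual r(x) = ∂₂Ψ(x, g x)
vanishes, and φ' = r g'. If r ≡ 0, then φ is constant and the critical points fill a curve, so none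
is isolated. Conversely, constant φ gives r g' = 0; were r nonzero somewhere, analyticity would make
g' ≡ 0, against g(x + L) = g(x) + L. The dichotomy is thus r ≡ 0 or r ≢ 0.

If r ≢ 0, its zeros are isolated. At a global maximum the positive mixed derivative forces ∂₁²Ψ < 0,
whence g' > 0 and r has the sign of φ': it passes from positive to negative. Being periodic, r also
passes from negative to positive somewhere. Near a point of the graph of g, ∂₁Ψ is positive above
the graph and negative below, while ∂₂Ψ = r on it. So the sign change of r determines the winding of
∇Ψ: +1 at the maximum, -1 at the other zero (`hasCriticalIndex_one`, `hasCriticalIndex_neg_one`). -/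

/-- The determinant of two plane vectors. -/
def cross (u v : Plane) : ℝ := u 0 * v 1 - u 1 * v 0

theorem inner_plane (u v : Plane) : ⟪u, v⟫ = u 0 * v 0 + u 1 * v 1 := by
  simp [PiLp.inner_apply, Fin.sum_univ_two, mul_comm]

theorem norm_sq_plane (u : Plane) : ‖u‖ ^ 2 = u 0 ^ 2 + u 1 ^ 2 := by
  rw [← real_inner_self_eq_norm_sq, inner_plane]; ring

/-- Expand `⟪a, b⟫` in the orthogonal frame formed by `w` and its quarter turn. This gives the mixed
derivative of the perimeter its sign and, for `a = b`, is Pythagoras. -/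
theorem cross_mul_cross (a b w : Plane) :
    cross a w * cross b w = ‖w‖ ^ 2 * ⟪a, b⟫ - ⟪a, w⟫ * ⟪b, w⟫ := by
  rw [norm_sq_plane, inner_plane, inner_plane, inner_plane, cross, cross]; ring

theorem cross_sub_swap (a u v : Plane) : cross a (u - v) = -cross a (v - u) := by
  simp [cross]; ring

theorem cross_smul_right (a u : Plane) (t : ℝ) : cross a (t • u) = t * cross a u := by
  simp [cross]; ring

theorem cross_zero_right (a : Plane) : cross a 0 = 0 := by simp [cross]

/-! ### The lifted curve and the twist property of the perimeter -/

/-- A closed analytic unit speed curve `c` of period `L`, strictly convex and winding around the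
origin. -/
structure IsOval (c : ℝ → Plane) (L : ℝ) : Prop where
  pos : 0 < L
  smooth : ContDiff ℝ ω c
  speed : ∀ t, ‖deriv c t‖ = 1
  periodic : ∀ t, c (t + L) = c t
  -- Products of two determinants keep both conditions independent of orientation. Here the chord
  -- leaves both of its endpoints on the same side of the oriented tangents; in `center`, the origin
  -- and `c y` lie on the same side of the tangent at `c x`.
  turning : ∀ x y, x < y → y < x + L →
    0 < cross (deriv c x) (c y - c x) * cross (deriv c y) (c x - c y)
  center : ∀ x y, x < y → y < x + L →
    cross (deriv c x) (c x) * cross (deriv c x) (c y - c x) < 0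

/-- The perimeter of the triangle with vertices `0`, `c x`, `c y`. -/
noncomputable def perimeter (c : ℝ → Plane) (x y : ℝ) : ℝ := ‖c x‖ + ‖c y‖ + ‖c y - c x‖

/-- The partial derivative of the perimeter in the first variable. -/
noncomputable def perimeterDeriv (c : ℝ → Plane) (x y : ℝ) : ℝ :=
  ⟪deriv c x, ‖c x‖⁻¹ • c x⟫ + ⟪deriv c x, ‖c x - c y‖⁻¹ • (c x - c y)⟫

theorem perimeter_comm (c : ℝ → Plane) (x y : ℝ) : perimeter c x y = perimeter c y x := by
  rw [perimeter, perimeter, norm_sub_rev]; ring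

theorem hasDerivAt_norm_curve {w : ℝ → Plane} {w' : Plane} {t : ℝ} (hw : HasDerivAt w w' t)
    (h0 : w t ≠ 0) : HasDerivAt (fun s => ‖w s‖) ⟪w', ‖w t‖⁻¹ • w t⟫ t := by
  have h1 := (hw.norm_sq).sqrt (by simpa using h0)
  have hn : ‖w t‖ ≠ 0 := norm_ne_zero_iff.2 h0
  have e : (fun s => ‖w s‖) = fun s => √(‖w s‖ ^ 2) := by
    ext s; rw [Real.sqrt_sq (norm_nonneg _)]
  rw [e]
  convert! h1 using 1
  rw [Real.sqrt_sq (norm_nonneg _), real_inner_smul_right, real_inner_comm]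
  field_simp

namespace IsOval

variable {c : ℝ → Plane} {L : ℝ}

theorem hasDerivAt (h : IsOval c L) (t : ℝ) : HasDerivAt c (deriv c t) t :=
  (h.smooth.differentiable (by simp) t).hasDerivAt

theorem deriv_periodic (h : IsOval c L) (t : ℝ) : deriv c (t + L) = deriv c t := by
  rw [← deriv_comp_add_const]
  congr 1; ext1 s; exact h.periodic s

theorem cross_self_ne (h : IsOval c L) (x : ℝ) : cross (deriv c x) (c x) ≠ 0 := by
  have := h.center x (x + L / 2) (by linarith [h.pos]) (by linarith [h.pos])
  intro h0; rw [h0] at this; simp at this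

theorem ne_zero (h : IsOval c L) (x : ℝ) : c x ≠ 0 := by
  intro h0; apply h.cross_self_ne x; rw [h0, cross_zero_right]

theorem sub_ne_zero (h : IsOval c L) {x y : ℝ} (h1 : x < y) (h2 : y < x + L) : c x - c y ≠ 0 := by
  intro h0; have := h.turning x y h1 h2
  rw [h0, cross_zero_right] at this; simp at this

theorem perimeterDeriv_periodic (h : IsOval c L) (x y : ℝ) :
    perimeterDeriv c (x + L) y = perimeterDeriv c x y := by
  simp only [perimeterDeriv, h.periodic, h.deriv_periodic]

theorem perimeterDeriv_periodic' (h : IsOval c L) (x y : ℝ) :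
    perimeterDeriv c x (y + L) = perimeterDeriv c x y := by
  simp only [perimeterDeriv, h.periodic]

theorem hasDerivAt_perimeter_left (h : IsOval c L) {x y : ℝ} (hxy : c x - c y ≠ 0) :
    HasDerivAt (fun s => perimeter c s y) (perimeterDeriv c x y) x := by
  have h1 := hasDerivAt_norm_curve (h.hasDerivAt x) (h.ne_zero x)
  have h2 := hasDerivAt_norm_curve ((h.hasDerivAt x).sub_const (c y)) hxy
  have := (h1.add_const ‖c y‖).add h2
  refine this.congr_of_eventuallyEq (.of_forall fun s => ?_)
  simp [perimeter, norm_sub_rev]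

/-- Only the unit chord vector depends on `y`; its derivative is the part of `-deriv c y` normal to
the chord, divided by the chord length. `cross_mul_cross` factors the result, so that `turning`
decides its sign. -/
theorem hasDerivAt_perimeterDeriv_right (h : IsOval c L) {x y : ℝ} (hxy : c x - c y ≠ 0) :
    HasDerivAt (fun s => perimeterDeriv c x s)
      (cross (deriv c x) (c y - c x) * cross (deriv c y) (c x - c y) / ‖c x - c y‖ ^ 3) y := by
  have h0 := (h.hasDerivAt y).const_sub (c x)
  have h1 := (hasDerivAt_norm_curve h0 hxy)
  have hn : ‖c x - c y‖ ≠ 0 := norm_ne_zero_iff.2 hxy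
  have h2 := (HasDerivAt.inner ℝ (hasDerivAt_const y (deriv c x)) ((h1.inv hn).smul h0)).const_add
    ⟪deriv c x, ‖c x‖⁻¹ • c x⟫
  refine h2.congr_deriv ?_
  rw [cross_sub_swap, neg_mul, cross_mul_cross]
  simp only [inner_add_right, real_inner_smul_right, inner_neg_right, inner_neg_left,
    inner_zero_left, Pi.inv_apply]
  field_simp
  ring

theorem contDiff_deriv (h : IsOval c L) : ContDiff ℝ ω (deriv c) :=
  ((contDiff_succ_iff_deriv (n := ω)).1 (by simpa using h.smooth)).2.2

theorem contDiffAt_perimeterDeriv (h : IsOval c L) {x y : ℝ} (hxy : c x - c y ≠ 0) :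
    ContDiffAt ℝ ω (fun p : ℝ × ℝ => perimeterDeriv c p.1 p.2) (x, y) := by
  have hx : ContDiffAt ℝ ω (fun p : ℝ × ℝ => c p.1) (x, y) :=
    (h.smooth.comp contDiff_fst).contDiffAt
  have hy : ContDiffAt ℝ ω (fun p : ℝ × ℝ => c p.2) (x, y) :=
    (h.smooth.comp contDiff_snd).contDiffAt
  have hd : ContDiffAt ℝ ω (fun p : ℝ × ℝ => deriv c p.1) (x, y) :=
    (h.contDiff_deriv.comp contDiff_fst).contDiffAt
  have n1 := (hx.norm ℝ (h.ne_zero x)).inv (norm_ne_zero_iff.2 (h.ne_zero x))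
  have n2 := ((hx.sub hy).norm ℝ hxy).inv (norm_ne_zero_iff.2 hxy)
  exact (hd.inner ℝ (n1.smul hx)).add (hd.inner ℝ (n2.smul (hx.sub hy)))

theorem contDiffAt_perimeter (h : IsOval c L) {x y : ℝ} (hxy : c x - c y ≠ 0) :
    ContDiffAt ℝ ω (fun p : ℝ × ℝ => perimeter c p.1 p.2) (x, y) := by
  have hx : ContDiffAt ℝ ω (fun p : ℝ × ℝ => c p.1) (x, y) :=
    (h.smooth.comp contDiff_fst).contDiffAt
  have hy : ContDiffAt ℝ ω (fun p : ℝ × ℝ => c p.2) (x, y) :=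
    (h.smooth.comp contDiff_snd).contDiffAt
  have hyx : c y - c x ≠ 0 := by rwa [← neg_sub, neg_ne_zero]
  exact ((hx.norm ℝ (h.ne_zero x)).add (hy.norm ℝ (h.ne_zero y))).add ((hy.sub hx).norm ℝ hyx)

theorem hasFDerivAt_perimeter (h : IsOval c L) {x y : ℝ} (hxy : c x - c y ≠ 0) :
    HasFDerivAt (fun p : ℝ × ℝ => perimeter c p.1 p.2)
      (perimeterDeriv c x y • ContinuousLinearMap.fst ℝ ℝ ℝ +
        perimeterDeriv c y x • ContinuousLinearMap.snd ℝ ℝ ℝ) (x, y) := by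
  have hd := ((h.contDiffAt_perimeter hxy).differentiableAt (by simp)).hasFDerivAt
  have hyx : c y - c x ≠ 0 := by rwa [← neg_sub, neg_ne_zero]
  have h1 : HasDerivAt (fun s => perimeter c s y) _ x :=
    hd.comp_hasDerivAt (f := fun s : ℝ => (s, y)) x ((hasDerivAt_id x).prodMk (hasDerivAt_const x y))
  have h2 : HasDerivAt (fun s => perimeter c x s) _ y :=
    hd.comp_hasDerivAt (f := fun s : ℝ => (x, s)) y ((hasDerivAt_const y x).prodMk (hasDerivAt_id y))
  have h3 : HasDerivAt (fun s => perimeter c x s) (perimeterDeriv c y x) y := by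
    simpa only [perimeter_comm c x] using h.hasDerivAt_perimeter_left hyx
  have e1 := h1.unique (h.hasDerivAt_perimeter_left hxy)
  have e2 := h2.unique h3
  convert! hd using 1
  refine ContinuousLinearMap.ext fun p => ?_
  have : p = p.1 • ((1 : ℝ), (0 : ℝ)) + p.2 • ((0 : ℝ), (1 : ℝ)) := by ext <;> simp
  conv_rhs => rw [this, map_add, map_smul, map_smul, e1, e2]
  simp [mul_comm]

theorem strictMonoOn_perimeterDeriv (h : IsOval c L) (x : ℝ) :
    StrictMonoOn (perimeterDeriv c x) (Ioo x (x + L)) := by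
  have key : ∀ y ∈ Ioo x (x + L), _ := fun y hy =>
    h.hasDerivAt_perimeterDeriv_right (h.sub_ne_zero hy.1 hy.2)
  refine strictMonoOn_of_deriv_pos (convex_Ioo _ _)
    (fun y hy => (key y hy).continuousAt.continuousWithinAt) fun y hy => ?_
  rw [interior_Ioo] at hy
  rw [(key y hy).deriv]
  exact div_pos (h.turning x y hy.1 hy.2)
    (pow_pos (norm_pos_iff.2 (h.sub_ne_zero hy.1 hy.2)) 3)

/-- Cauchy–Schwarz is strict because the origin is off the tangent line at `c x`. This makes the
one-sided limits below have opposite signs. -/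
theorem abs_inner_lt_one (h : IsOval c L) (x : ℝ) : |⟪deriv c x, ‖c x‖⁻¹ • c x⟫| < 1 := by
  have hn : 0 < ‖c x‖ := norm_pos_iff.2 (h.ne_zero x)
  have h1 := cross_mul_cross (deriv c x) (deriv c x) (c x)
  rw [real_inner_self_eq_norm_sq, h.speed] at h1
  have h2 : 0 < cross (deriv c x) (c x) * cross (deriv c x) (c x) :=
    mul_self_pos.2 (h.cross_self_ne x)
  rw [real_inner_smul_right, abs_mul, abs_inv, abs_norm, inv_mul_lt_one₀ hn]
  exact abs_lt_of_sq_lt_sq (by nlinarith) hn.le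

theorem tendsto_unit_chord (h : IsOval c L) (x : ℝ) :
    Tendsto (fun y => ‖slope c x y‖⁻¹ • slope c x y) (𝓝[≠] x) (𝓝 (deriv c x)) := by
  have h1 := (h.hasDerivAt x).tendsto_slope
  have h2 := (h1.norm.inv₀ (by rw [h.speed]; simp)).smul h1
  simpa [h.speed] using h2

theorem tendsto_perimeterDeriv_right (h : IsOval c L) (x : ℝ) :
    Tendsto (perimeterDeriv c x) (𝓝[>] x) (𝓝 (⟪deriv c x, ‖c x‖⁻¹ • c x⟫ - 1)) := by
  have h1 := (h.tendsto_unit_chord x).mono_left (nhdsWithin_mono x (fun y (hy : x < y) => hy.ne'))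
  have h2 := ((tendsto_const_nhds (x := deriv c x)).inner (𝕜 := ℝ) h1).const_sub
    ⟪deriv c x, ‖c x‖⁻¹ • c x⟫
  rw [real_inner_self_eq_norm_sq, h.speed, one_pow] at h2
  refine h2.congr' ?_
  filter_upwards [self_mem_nhdsWithin] with y (hy : x < y)
  have hp : 0 < y - x := sub_pos.2 hy
  rw [perimeterDeriv, slope_def_module, norm_smul, norm_inv, Real.norm_of_nonneg hp.le,
    smul_smul, mul_inv, inv_inv, mul_right_comm, mul_inv_cancel₀ hp.ne', one_mul,
    ← neg_sub (c y) (c x), norm_neg, smul_neg, inner_neg_right]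
  ring

theorem tendsto_perimeterDeriv_left (h : IsOval c L) (x : ℝ) :
    Tendsto (perimeterDeriv c x) (𝓝[<] x) (𝓝 (⟪deriv c x, ‖c x‖⁻¹ • c x⟫ + 1)) := by
  have h1 := (h.tendsto_unit_chord x).mono_left (nhdsWithin_mono x (fun y (hy : y < x) => hy.ne))
  have h2 := ((tendsto_const_nhds (x := deriv c x)).inner (𝕜 := ℝ) h1).const_add
    ⟪deriv c x, ‖c x‖⁻¹ • c x⟫
  rw [real_inner_self_eq_norm_sq, h.speed, one_pow] at h2
  refine h2.congr' ?_
  filter_upwards [self_mem_nhdsWithin] with y (hy : y < x)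
  have hp : 0 < x - y := sub_pos.2 hy
  rw [perimeterDeriv, slope_comm, slope_def_module, norm_smul, norm_inv,
    Real.norm_of_nonneg hp.le, smul_smul, mul_inv, inv_inv, mul_right_comm,
    mul_inv_cancel₀ hp.ne', one_mul]

theorem exists_perimeterDeriv_eq_zero (h : IsOval c L) (x : ℝ) :
    ∃ y ∈ Ioo x (x + L), perimeterDeriv c x y = 0 := by
  have hx := abs_lt.1 (h.abs_inner_lt_one x)
  have hL := h.pos
  obtain ⟨a, ha, ha'⟩ := (((h.tendsto_perimeterDeriv_right x).eventually
    (gt_mem_nhds (show _ < (0 : ℝ) by linarith))).and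
    (Ioo_mem_nhdsGT (show x < x + L by linarith))).exists
  obtain ⟨b, hb, hb'⟩ := (((h.tendsto_perimeterDeriv_left x).eventually
    (lt_mem_nhds (show (0 : ℝ) < _ by linarith))).and
    (Ioo_mem_nhdsLT (show x - L < x by linarith))).exists
  -- The limit from the left at `x` serves, by periodicity, as the limit at the far end `x + L`.
  rw [← h.perimeterDeriv_periodic'] at hb
  have hbI : b + L ∈ Ioo x (x + L) := ⟨by linarith [hb'.1], by linarith [hb'.2]⟩
  have hc : ContinuousOn (perimeterDeriv c x) (Ioo x (x + L)) := fun y hy =>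
    (h.hasDerivAt_perimeterDeriv_right
      (h.sub_ne_zero hy.1 hy.2)).continuousAt.continuousWithinAt
  obtain ⟨y, hy, hy0⟩ := isPreconnected_Ioo.intermediate_value ha' hbI hc ⟨ha.le, hb.le⟩
  exact ⟨y, hy, hy0⟩

end IsOval

/-! ### The reflection map, and sign changes of continuous functions -/

/-- `g` sends `x` to the parameter in `(x, x + L)` at which the ray from the origin, reflected at
`c x`, hits the curve again. -/
structure IsBounce (c : ℝ → Plane) (L : ℝ) (g : ℝ → ℝ) : Prop where
  mem : ∀ x, g x ∈ Ioo x (x + L)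
  eq_zero : ∀ x, perimeterDeriv c x (g x) = 0

theorem eventually_pos_or_neg_right {f : ℝ → ℝ} (hf : Continuous f) {a : ℝ}
    (ha : ∀ᶠ x in 𝓝[>] a, f x ≠ 0) :
    (∀ᶠ x in 𝓝[>] a, 0 < f x) ∨ ∀ᶠ x in 𝓝[>] a, f x < 0 := by
  obtain ⟨b, hb, hs⟩ := (mem_nhdsGT_iff_exists_Ioo_subset).1 ha
  by_cases h : ∃ x ∈ Ioo a b, 0 < f x
  · obtain ⟨x, hx, hx0⟩ := h
    left
    filter_upwards [Ioo_mem_nhdsGT hb] with y hy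
    by_contra! hy0
    obtain ⟨z, hz, hz0⟩ := isPreconnected_Ioo.intermediate_value hy hx hf.continuousOn
      ⟨hy0, hx0.le⟩
    exact hs hz hz0
  · right
    filter_upwards [Ioo_mem_nhdsGT hb] with y hy
    push Not at h
    exact lt_of_le_of_ne (h y hy) (hs hy)

theorem eventually_pos_or_neg_left {f : ℝ → ℝ} (hf : Continuous f) {a : ℝ}
    (ha : ∀ᶠ x in 𝓝[<] a, f x ≠ 0) :
    (∀ᶠ x in 𝓝[<] a, 0 < f x) ∨ ∀ᶠ x in 𝓝[<] a, f x < 0 := by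
  obtain ⟨b, hb, hs⟩ := (mem_nhdsLT_iff_exists_Ioo_subset).1 ha
  by_cases h : ∃ x ∈ Ioo b a, 0 < f x
  · obtain ⟨x, hx, hx0⟩ := h
    left
    filter_upwards [Ioo_mem_nhdsLT hb] with y hy
    by_contra! hy0
    obtain ⟨z, hz, hz0⟩ := isPreconnected_Ioo.intermediate_value hy hx hf.continuousOn
      ⟨hy0, hx0.le⟩
    exact hs hz hz0
  · right
    filter_upwards [Ioo_mem_nhdsLT hb] with y hy
    push Not at h
    exact lt_of_le_of_ne (h y hy) (hs hy)

/-- A continuous function with isolated zeros which is negative at `a` and positive at `b > a`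
has a zero at which it changes sign from negative to positive. -/
theorem exists_sign_change {f : ℝ → ℝ} (hf : Continuous f) (h0 : ∀ a, ∀ᶠ x in 𝓝[≠] a, f x ≠ 0)
    {a b : ℝ} (hab : a < b) (ha : f a < 0) (hb : 0 < f b) :
    ∃ z, (∀ᶠ x in 𝓝[<] z, f x < 0) ∧ ∀ᶠ x in 𝓝[>] z, 0 < f x := by
  -- The sign change occurs at the supremum of the negative set: `f` cannot be negative just to its
  -- right, nor positive just to its left.
  set S := {x ∈ Icc a b | f x < 0}
  have haS : a ∈ S := ⟨left_mem_Icc.2 hab.le, ha⟩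
  have hbd : BddAbove S := ⟨b, fun x hx => hx.1.2⟩
  have hlub := isLUB_csSup ⟨a, haS⟩ hbd
  set z := sSup S
  have haz : a ≤ z := hlub.1 haS
  have hzb : z ≤ b := hlub.2 fun x hx => hx.1.2
  have hz0 : f z ≤ 0 := by
    have : closure S ⊆ {x | f x ≤ 0} :=
      closure_minimal (fun x hx => hx.2.le) (isClosed_le hf continuous_const)
    exact this (hlub.mem_closure ⟨a, haS⟩)
  have hzb' : z < b := lt_of_le_of_ne hzb fun h => by rw [h] at hz0; linarith
  have hright : ¬ ∀ᶠ x in 𝓝[>] z, f x < 0 := by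
    intro h
    obtain ⟨x, hx, hxI⟩ := (h.and (Ioo_mem_nhdsGT hzb')).exists
    exact absurd (hlub.1 ⟨⟨haz.trans hxI.1.le, hxI.2.le⟩, hx⟩) (not_le.2 hxI.1)
  have hzS : z ∉ S := fun h =>
    hright (nhdsWithin_le_nhds (hf.continuousAt.eventually (gt_mem_nhds h.2)))
  have hleft : ¬ ∀ᶠ x in 𝓝[<] z, 0 < f x := by
    intro h
    have h1 := hlub.frequently_mem ⟨a, haS⟩
    rw [← Iio_insert, nhdsWithin_insert, frequently_sup] at h1
    rcases h1 with h1 | h1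
    · exact hzS (by simpa using h1)
    · obtain ⟨x, hx, hx'⟩ := (h1.and_eventually h).exists
      exact absurd hx.2 (not_lt.2 hx'.le)
  refine ⟨z, ?_, ?_⟩
  · exact (eventually_pos_or_neg_left hf
      ((h0 z).filter_mono (nhdsWithin_mono z fun x (hx : x < z) => hx.ne))).resolve_left hleft
  · exact (eventually_pos_or_neg_right hf
      ((h0 z).filter_mono (nhdsWithin_mono z fun x (hx : z < x) => hx.ne'))).resolve_right hright

/-! ### Analyticity of the reflection map and signs of the residual -/

namespace IsBounce

variable {c : ℝ → Plane} {L : ℝ} {g : ℝ → ℝ}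

theorem sub_ne_zero (hg : IsBounce c L g) (h : IsOval c L) (x : ℝ) : c x - c (g x) ≠ 0 :=
  h.sub_ne_zero (hg.mem x).1 (hg.mem x).2

theorem unique (hg : IsBounce c L g) (h : IsOval c L) {x y : ℝ} (hy : y ∈ Ioo x (x + L))
    (hxy : perimeterDeriv c x y = 0) : y = g x :=
  (h.strictMonoOn_perimeterDeriv x).injOn hy (hg.mem x) (hxy.trans (hg.eq_zero x).symm)

theorem periodic (hg : IsBounce c L g) (h : IsOval c L) (x : ℝ) : g (x + L) = g x + L := by
  have hx := hg.mem x
  refine (hg.unique h ⟨by linarith [hx.1], by linarith [hx.2]⟩ ?_).symm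
  rw [h.perimeterDeriv_periodic, h.perimeterDeriv_periodic', hg.eq_zero]

/-- The partial derivative of the first-variable derivative in the second variable is positive. -/
theorem fderiv_snd_pos (h : IsOval c L) {x y : ℝ} (hxy : c x - c y ≠ 0)
    (ht : 0 < cross (deriv c x) (c y - c x) * cross (deriv c y) (c x - c y)) :
    0 < fderiv ℝ (fun p : ℝ × ℝ => perimeterDeriv c p.1 p.2) (x, y) (0, 1) := by
  have hd := ((h.contDiffAt_perimeterDeriv hxy).differentiableAt (by simp)).hasFDerivAt
  have h2 : HasDerivAt (fun s => perimeterDeriv c x s) _ y :=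
    hd.comp_hasDerivAt (f := fun s : ℝ => (x, s)) y
      ((hasDerivAt_const y x).prodMk (hasDerivAt_id y))
  rw [h2.unique (h.hasDerivAt_perimeterDeriv_right hxy)]
  exact div_pos ht (pow_pos (norm_pos_iff.2 hxy) 3)

/-- The twist makes the analytic implicit function theorem applicable. No continuity of `g` is
needed beforehand: the local solution stays in `(s, s + L)`, where the zero is unique. -/
theorem contDiff (hg : IsBounce c L g) (h : IsOval c L) : ContDiff ℝ ω g := by
  rw [contDiff_iff_contDiffAt]
  intro x
  have cdf := h.contDiffAt_perimeterDeriv (hg.sub_ne_zero h x)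
  have hpos := fderiv_snd_pos h (hg.sub_ne_zero h x) (h.turning x _ (hg.mem x).1 (hg.mem x).2)
  have inv : (fderiv ℝ (fun p : ℝ × ℝ => perimeterDeriv c p.1 p.2) (x, g x) ∘L
      .inr ℝ ℝ ℝ).IsInvertible := by
    refine ⟨ContinuousLinearEquiv.unitsEquivAut ℝ (Units.mk0 _ hpos.ne'), ?_⟩
    ext
    simp
  have hn : (ω : WithTop ℕ∞) ≠ 0 := by simp
  refine (cdf.contDiffAt_implicitFunction hn inv).congr_of_eventuallyEq ?_
  have hval := cdf.eventually_apply_implicitFunction hn inv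
  have hself := cdf.implicitFunction_apply_self hn inv
  have hcont := (cdf.contDiffAt_implicitFunction hn inv).continuousAt
  set ψ := cdf.implicitFunction hn inv
  simp only [hg.eq_zero] at hval hself hcont
  have h1 : ∀ᶠ s in 𝓝 x, s < ψ s :=
    continuousAt_id.eventually_lt hcont (by rw [hself]; exact (hg.mem x).1)
  have h2 : ∀ᶠ s in 𝓝 x, ψ s < s + L :=
    hcont.eventually_lt (continuousAt_id.add continuousAt_const)
      (by rw [hself]; exact (hg.mem x).2)
  filter_upwards [hval, h1, h2] with s hs hs1 hs2
  exact (hg.unique h ⟨hs1, hs2⟩ hs).symm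

theorem contDiff_residual (hg : IsBounce c L g) (h : IsOval c L) :
    ContDiff ℝ ω fun x => perimeterDeriv c (g x) x := by
  rw [contDiff_iff_contDiffAt]
  intro x
  have hne : c (g x) - c x ≠ 0 := by
    rw [← neg_sub, neg_ne_zero]; exact hg.sub_ne_zero h x
  exact (h.contDiffAt_perimeterDeriv hne).comp (f := fun s : ℝ => (g s, s)) x
    ((hg.contDiff h).contDiffAt.prodMk contDiffAt_id)

theorem hasDerivAt (hg : IsBounce c L g) (h : IsOval c L) (x : ℝ) :
    HasDerivAt g (deriv g x) x :=
  ((hg.contDiff h).differentiable (by simp) x).hasDerivAt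

/-- Chain rule: the first partial derivative vanishes on the graph, so only the residual times
`deriv g` survives. -/
theorem hasDerivAt_perimeter (hg : IsBounce c L g) (h : IsOval c L) (x : ℝ) :
    HasDerivAt (fun s => perimeter c s (g s)) (perimeterDeriv c (g x) x * deriv g x) x := by
  have := (h.hasFDerivAt_perimeter (hg.sub_ne_zero h x)).comp_hasDerivAt
    (f := fun s : ℝ => (s, g s)) x ((hasDerivAt_id x).prodMk (hg.hasDerivAt h x))
  simpa [hg.eq_zero, Function.comp_def] using! this

theorem perimeter_const_of_residual_eq_zero (hg : IsBounce c L g) (h : IsOval c L)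
    (h0 : ∀ x, perimeterDeriv c (g x) x = 0) (x y : ℝ) :
    perimeter c x (g x) = perimeter c y (g y) := by
  refine is_const_of_deriv_eq_zero (f := fun s => perimeter c s (g s))
    (fun s => (hg.hasDerivAt_perimeter h s).differentiableAt) (fun s => ?_) x y
  rw [(hg.hasDerivAt_perimeter h s).deriv, h0, zero_mul]

theorem residual_eq_zero_of_perimeter_const (hg : IsBounce c L g) (h : IsOval c L) {C : ℝ}
    (hC : ∀ x, perimeter c x (g x) = C) (x : ℝ) : perimeterDeriv c (g x) x = 0 := by
  by_contra hx
  have hmul : ∀ s, perimeterDeriv c (g s) s * deriv g s = 0 := by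
    intro s
    have := hg.hasDerivAt_perimeter h s
    simp only [hC] at this
    exact this.unique (hasDerivAt_const s C)
  have hev : deriv g =ᶠ[𝓝 x] 0 := by
    filter_upwards [(hg.contDiff_residual h).continuous.continuousAt.eventually_ne hx] with s hs
    exact (mul_eq_zero.1 (hmul s)).resolve_left hs
  -- Identity theorem: `deriv g` vanishes on an open set, hence everywhere, which contradicts `g (x
  -- + L) = g x + L`.
  have hd : deriv g = 0 :=
    ((contDiff_omega_iff_analyticOnNhd.1 (hg.contDiff h)).deriv).eq_of_eventuallyEq
      analyticOnNhd_const hev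
  have := is_const_of_deriv_eq_zero ((hg.contDiff h).differentiable (by simp))
    (fun s => congrFun hd s) (x + L) x
  linarith [hg.periodic h x, h.pos]

theorem eventually_residual_ne_zero (hg : IsBounce c L g) (h : IsOval c L) {x₀ : ℝ}
    (h0 : perimeterDeriv c (g x₀) x₀ ≠ 0) (x : ℝ) :
    ∀ᶠ s in 𝓝[≠] x, perimeterDeriv c (g s) s ≠ 0 := by
  have han := contDiff_omega_iff_analyticOnNhd.1 (hg.contDiff_residual h)
  rcases (han x (mem_univ x)).eventually_eq_zero_or_eventually_ne_zero with h1 | h1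
  · exact absurd (congrFun (han.eq_of_eventuallyEq analyticOnNhd_const h1) x₀) h0
  · exact h1

theorem residual_periodic (hg : IsBounce c L g) (h : IsOval c L) (x : ℝ) :
    perimeterDeriv c (g (x + L)) (x + L) = perimeterDeriv c (g x) x := by
  rw [hg.periodic h, h.perimeterDeriv_periodic, h.perimeterDeriv_periodic']

/-- At a local maximum of the perimeter on the graph of `g`, the map `g` is increasing. -/
theorem deriv_pos_of_max (hg : IsBounce c L g) (h : IsOval c L) {x : ℝ}
    (hmax : ∀ s t, perimeter c s t ≤ perimeter c x (g x))
    (hcrit : perimeterDeriv c (g x) x = 0) : 0 < deriv g x := by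
  set y := g x with hy
  have hxy : c x - c y ≠ 0 := hg.sub_ne_zero h x
  have hyx : c y - c x ≠ 0 := by rwa [← neg_sub, neg_ne_zero]
  have ht := h.turning x _ (hg.mem x).1 (hg.mem x).2
  have hA := ((h.contDiffAt_perimeterDeriv hxy).differentiableAt (by simp)).hasFDerivAt
  have hB := ((h.contDiffAt_perimeterDeriv hyx).differentiableAt (by simp)).hasFDerivAt
  have hb := fderiv_snd_pos h hxy ht
  have hb' := fderiv_snd_pos h hyx (by rwa [mul_comm])
  set A := fderiv ℝ (fun p : ℝ × ℝ => perimeterDeriv c p.1 p.2) (x, y)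
  set B := fderiv ℝ (fun p : ℝ × ℝ => perimeterDeriv c p.1 p.2) (y, x)
  have hlin : ∀ (T : ℝ × ℝ →L[ℝ] ℝ) (a b : ℝ), T (a, b) = a * T (1, 0) + b * T (0, 1) := by
    intro T a b
    have : (a, b) = a • ((1 : ℝ), (0 : ℝ)) + b • ((0 : ℝ), (1 : ℝ)) := by simp
    rw [this, map_add, map_smul, map_smul, smul_eq_mul, smul_eq_mul]
  -- `A (1, 0)` is ∂₁²Ψ. Were it nonnegative, the second derivative ∂₁²Ψ + 2s ∂₁∂₂Ψ + s² ∂₂²Ψ in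
  -- direction `(1, s)` would be positive for small `s > 0`, which is impossible at a maximum.
  have ha : A (1, 0) < 0 := by
    by_contra! ha
    obtain ⟨s, hs, hpos⟩ : ∃ s : ℝ, 0 < s ∧ 0 < A (1, s) + s * B (s, 1) := by
      have hc : Tendsto (fun s : ℝ => A (0, 1) + (s * B (1, 0) + B (0, 1))) (𝓝[>] 0)
          (𝓝 (A (0, 1) + (0 * B (1, 0) + B (0, 1)))) :=
        (Continuous.tendsto (by fun_prop) 0).mono_left nhdsWithin_le_nhds
      obtain ⟨s, hs, hs0⟩ := ((hc.eventually (lt_mem_nhds (show (0 : ℝ) < _ by linarith))).and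
        self_mem_nhdsWithin).exists
      refine ⟨s, hs0, ?_⟩
      rw [hlin A, hlin B]
      have := mul_pos (show (0 : ℝ) < s from hs0) hs
      linarith
    have hl1 : ∀ t : ℝ, HasDerivAt (fun t : ℝ => x + t) 1 t := fun t =>
      (hasDerivAt_id t).const_add x
    have hl2 : ∀ t : ℝ, HasDerivAt (fun t : ℝ => y + s * t) s t := fun t => by
      simpa using ((hasDerivAt_id t).const_mul s).const_add y
    have hk : ∀ᶠ t in 𝓝 (0 : ℝ), HasDerivAt (fun t => perimeter c (x + t) (y + s * t))
        (perimeterDeriv c (x + t) (y + s * t) + s * perimeterDeriv c (y + s * t) (x + t)) t := by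
      have hcont : ContinuousAt (fun t : ℝ => c (x + t) - c (y + s * t)) 0 := by
        have := h.smooth.continuous
        fun_prop
      filter_upwards [hcont.eventually_ne (by simpa using hxy)] with t htne
      have := (h.hasFDerivAt_perimeter htne).comp_hasDerivAt
        (f := fun t : ℝ => (x + t, y + s * t)) t ((hl1 t).prodMk (hl2 t))
      simpa [Function.comp_def, mul_comm] using! this
    have hk' : HasDerivAt (fun t => perimeterDeriv c (x + t) (y + s * t) +
        s * perimeterDeriv c (y + s * t) (x + t)) (A (1, s) + s * B (s, 1)) 0 := by
      have e1 := HasFDerivAt.comp_hasDerivAt_of_eq (f := fun t : ℝ => (x + t, y + s * t)) 0 hA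
        ((hl1 0).prodMk (hl2 0)) (by simp)
      have e2 := HasFDerivAt.comp_hasDerivAt_of_eq (f := fun t : ℝ => (y + s * t, x + t)) 0 hB
        ((hl2 0).prodMk (hl1 0)) (by simp)
      exact e1.add (e2.const_mul s)
    set k : ℝ → ℝ := fun t => perimeter c (x + t) (y + s * t)
    have hdk : deriv k =ᶠ[𝓝 0] fun t => perimeterDeriv c (x + t) (y + s * t) +
        s * perimeterDeriv c (y + s * t) (x + t) := hk.mono fun t ht => ht.deriv
    have hddk : deriv (deriv k) 0 = A (1, s) + s * B (s, 1) := by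
      rw [hdk.deriv_eq]; exact hk'.deriv
    -- A local minimum that is also a maximum makes `k` locally constant, contradicting its positive
    -- second derivative.
    have hmin : IsLocalMin k 0 := by
      refine isLocalMin_of_deriv_deriv_pos (by rw [hddk]; exact hpos) ?_
        hk.self_of_nhds.continuousAt
      rw [hdk.self_of_nhds]
      have hxy0 : perimeterDeriv c x y = 0 := hg.eq_zero x
      simp [hcrit, hxy0]
    have hconst : k =ᶠ[𝓝 0] fun _ => k 0 := by
      filter_upwards [hmin] with t ht
      refine le_antisymm ?_ ht
      simpa [k] using hmax (x + t) (y + s * t)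
    have : deriv (deriv k) 0 = 0 := by
      rw [hconst.deriv.deriv_eq]; simp
    linarith
  -- Differentiating ∂₁Ψ(s, g s) = 0 gives ∂₁²Ψ + g' ∂₁∂₂Ψ = 0, so g' > 0.
  have hzero := hA.comp_hasDerivAt (f := fun s : ℝ => (s, g s)) x
    ((hasDerivAt_id x).prodMk (hg.hasDerivAt h x))
  have hfun : ((fun p : ℝ × ℝ => perimeterDeriv c p.1 p.2) ∘ fun s : ℝ => (s, g s)) =
      fun _ => 0 := by ext s; exact hg.eq_zero s
  rw [hfun] at hzero
  have := hzero.unique (hasDerivAt_const x 0)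
  rw [hlin] at this
  by_contra! hneg
  nlinarith

theorem residual_eq_zero_of_max (hg : IsBounce c L g) (h : IsOval c L) {x : ℝ}
    (hmax : ∀ s t, perimeter c s t ≤ perimeter c x (g x)) : perimeterDeriv c (g x) x = 0 := by
  have hyx : c (g x) - c x ≠ 0 := by rw [← neg_sub, neg_ne_zero]; exact hg.sub_ne_zero h x
  refine IsLocalMax.hasDerivAt_eq_zero (.of_forall fun t => ?_)
    (h.hasDerivAt_perimeter_left hyx)
  rw [perimeter_comm c (g x) x]
  exact hmax _ _

/-- At a global maximum of the perimeter, the residual changes sign from positive to negative. -/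
theorem residual_sign_of_max (hg : IsBounce c L g) (h : IsOval c L) {x₀ : ℝ}
    (h0 : perimeterDeriv c (g x₀) x₀ ≠ 0) {x : ℝ}
    (hmax : ∀ s t, perimeter c s t ≤ perimeter c x (g x)) :
    (∀ᶠ s in 𝓝[<] x, 0 < perimeterDeriv c (g s) s) ∧
      ∀ᶠ s in 𝓝[>] x, perimeterDeriv c (g s) s < 0 := by
  have hcont := (hg.contDiff_residual h).continuous
  have hne := hg.eventually_residual_ne_zero h h0 x
  have hg' : ∀ᶠ s in 𝓝 x, 0 < deriv g s :=
    ((hg.contDiff h).continuous_deriv (by simp)).continuousAt.eventually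
      (lt_mem_nhds (hg.deriv_pos_of_max h hmax (hg.residual_eq_zero_of_max h hmax)))
  have hcφ : Continuous fun s => perimeter c s (g s) :=
    continuous_iff_continuousAt.2 fun s => (hg.hasDerivAt_perimeter h s).continuousAt
  constructor
  -- As g' > 0 near `x`, the wrong sign of the residual would make the perimeter along the graph
  -- exceed its maximum.
  · refine (eventually_pos_or_neg_left hcont
      (hne.filter_mono (nhdsWithin_mono x fun s (hs : s < x) => hs.ne))).resolve_right fun hneg => ?_
    obtain ⟨b, hb, hs⟩ := mem_nhdsLT_iff_exists_Ioo_subset.1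
      (hneg.and (nhdsWithin_le_nhds hg'))
    have : StrictAntiOn (fun s => perimeter c s (g s)) (Icc b x) := by
      refine strictAntiOn_of_deriv_neg (convex_Icc b x) hcφ.continuousOn fun s hsI => ?_
      rw [interior_Icc] at hsI
      rw [(hg.hasDerivAt_perimeter h s).deriv]
      exact mul_neg_of_neg_of_pos (hs hsI).1 (hs hsI).2
    exact absurd (this (left_mem_Icc.2 hb.le) (right_mem_Icc.2 hb.le) hb) (not_lt.2 (hmax _ _))
  · refine (eventually_pos_or_neg_right hcont
      (hne.filter_mono (nhdsWithin_mono x fun s (hs : x < s) => hs.ne'))).resolve_left fun hneg => ?_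
    obtain ⟨b, hb, hs⟩ := mem_nhdsGT_iff_exists_Ioo_subset.1
      (hneg.and (nhdsWithin_le_nhds hg'))
    have : StrictMonoOn (fun s => perimeter c s (g s)) (Icc x b) := by
      refine strictMonoOn_of_deriv_pos (convex_Icc x b) hcφ.continuousOn fun s hsI => ?_
      rw [interior_Icc] at hsI
      rw [(hg.hasDerivAt_perimeter h s).deriv]
      exact mul_pos (hs hsI).1 (hs hsI).2
    exact absurd (this (left_mem_Icc.2 (le_of_lt hb)) (right_mem_Icc.2 (le_of_lt hb)) hb)
      (not_lt.2 (hmax _ _))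

/-- If the residual changes sign from positive to negative somewhere, then it also changes sign
from negative to positive somewhere. -/
theorem exists_residual_sign_change (hg : IsBounce c L g) (h : IsOval c L) {x : ℝ}
    (hl : ∀ᶠ s in 𝓝[<] x, 0 < perimeterDeriv c (g s) s)
    (hr : ∀ᶠ s in 𝓝[>] x, perimeterDeriv c (g s) s < 0) :
    ∃ z, (∀ᶠ s in 𝓝[<] z, perimeterDeriv c (g s) s < 0) ∧
      ∀ᶠ s in 𝓝[>] z, 0 < perimeterDeriv c (g s) s := by
  have hL := h.pos
  obtain ⟨a, ha, haI⟩ := (hr.and (Ioo_mem_nhdsGT (show x < x + L / 2 by linarith))).exists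
  obtain ⟨b, hb, hbI⟩ := (hl.and (Ioo_mem_nhdsLT (show x - L / 2 < x by linarith))).exists
  -- Moving `b` one period to the right puts the positive value after the negative one at `a`.
  rw [← hg.residual_periodic h] at hb
  exact exists_sign_change (hg.contDiff_residual h).continuous
    (hg.eventually_residual_ne_zero h ha.ne) (by linarith [haI.2, hbI.1]) ha hb

end IsBounce

/-! ### Winding numbers from axis crossings -/

theorem arg_I_mul_of_re_pos {w : ℂ} (hw : 0 < w.re) :
    Complex.arg (Complex.I * w) = Complex.arg w + Real.pi / 2 := by
  have h0 : w ≠ 0 := fun h => by simp [h] at hw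
  have h := abs_lt.1 (Complex.abs_arg_lt_pi_div_two_iff.2 (.inl hw))
  rw [(Complex.arg_mul_eq_add_arg_iff Complex.I_ne_zero h0).2, Complex.arg_I, add_comm]
  rw [Complex.arg_I]
  exact ⟨by linarith [Real.pi_pos], by linarith⟩

theorem arg_neg_I_mul_of_re_pos {w : ℂ} (hw : 0 < w.re) :
    Complex.arg (-Complex.I * w) = Complex.arg w - Real.pi / 2 := by
  have h0 : w ≠ 0 := fun h => by simp [h] at hw
  have h := abs_lt.1 (Complex.abs_arg_lt_pi_div_two_iff.2 (.inl hw))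
  rw [(Complex.arg_mul_eq_add_arg_iff (neg_ne_zero.2 Complex.I_ne_zero) h0).2, Complex.arg_neg_I]
  · ring
  rw [Complex.arg_neg_I]
  exact ⟨by linarith, by linarith [Real.pi_pos]⟩

open Complex in
/-- A continuous closed planar curve which meets the imaginary axis only in the lower half-axis
for `cos t > 0` and only in the upper half-axis for `cos t < 0` has winding number one. -/
theorem exists_argument_of_axis_crossings {V : ℝ → ℂ} (hV : Continuous V)
    (hper : V (2 * Real.pi) = V 0)
    (hr : ∀ t, 0 < Real.cos t → (V t).re = 0 → (V t).im < 0)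
    (hl : ∀ t, Real.cos t < 0 → (V t).re = 0 → 0 < (V t).im)
    (ht : 0 < (V (Real.pi / 2)).re) (hb : (V (3 * Real.pi / 2)).re < 0) :
    ∃ θ : ℝ → ℝ, ContinuousOn θ (Icc 0 (2 * Real.pi)) ∧
      (∀ t ∈ Icc 0 (2 * Real.pi), V t ≠ 0 ∧ V t = (‖V t‖ : ℂ) * exp ((θ t : ℂ) * I)) ∧
      θ (2 * Real.pi) - θ 0 = 2 * Real.pi := by
  have hπ := Real.pi_pos
  -- Up to constants, `A` and `B` are the branches of the argument of `V` cut along the upper and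
  -- the lower imaginary half-axis. `A` is used where `cos t ≥ 0`, `B` where `cos t ≤ 0`.
  set A : ℝ → ℝ := fun t => arg (I * V t)
  set B : ℝ → ℝ := fun t => arg (-I * V t)
  have hAB : A (Real.pi / 2) - Real.pi / 2 = B (Real.pi / 2) + Real.pi / 2 := by
    simp only [A, B]
    rw [arg_I_mul_of_re_pos ht, arg_neg_I_mul_of_re_pos ht]
    ring
  -- In the left half-plane the two branches differ by a full turn. The constant of `A` therefore
  -- grows from `-π/2` to `3π/2`, and this is the winding.
  have hBA : B (3 * Real.pi / 2) + Real.pi / 2 = A (3 * Real.pi / 2) + 3 * Real.pi / 2 := by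
    have hw : 0 < (-V (3 * Real.pi / 2)).re := by simpa using hb
    have h1 := arg_I_mul_of_re_pos hw
    have h2 := arg_neg_I_mul_of_re_pos hw
    rw [mul_neg, ← neg_mul] at h1
    rw [neg_mul_neg] at h2
    simp only [A, B, h1, h2]
    ring
  have slitA : ∀ t, (0 < Real.cos t ∨ t = Real.pi / 2 ∨ t = 3 * Real.pi / 2) →
      I * V t ∈ slitPlane := by
    intro t h
    rw [mem_slitPlane_iff]
    simp only [mul_re, mul_im, I_re, I_im, zero_mul, one_mul, zero_sub, zero_add]
    rcases h with h | rfl | rfl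
    · by_cases h0 : (V t).re = 0
      · left; linarith [hr t h h0]
      · right; simpa using h0
    · right; simpa using ht.ne'
    · right; simpa using hb.ne
  have slitB : ∀ t, (Real.cos t < 0 ∨ t = Real.pi / 2 ∨ t = 3 * Real.pi / 2) →
      -I * V t ∈ slitPlane := by
    intro t h
    rw [mem_slitPlane_iff]
    simp only [mul_re, mul_im, I_re, I_im, neg_re, neg_im]
    rcases h with h | rfl | rfl
    · by_cases h0 : (V t).re = 0
      · left; linarith [hl t h h0]
      · right; simpa using h0
    · right; simpa using ht.ne'
    · right; simpa using hb.ne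
  have polA : ∀ t k : ℝ, exp ((k : ℂ) * I) = -I → I * V t ∈ slitPlane →
      V t ≠ 0 ∧ V t = (‖V t‖ : ℂ) * exp (((A t + k : ℝ) : ℂ) * I) := by
    intro t k hk hs
    refine ⟨fun h0 => slitPlane_ne_zero hs (by simp [h0]), ?_⟩
    have := norm_mul_exp_arg_mul_I (I * V t)
    rw [norm_mul, norm_I, one_mul] at this
    rw [ofReal_add, add_mul, exp_add, hk, ← mul_assoc, this]
    linear_combination (V t) * I_mul_I
  have polB : ∀ t, -I * V t ∈ slitPlane →
      V t ≠ 0 ∧ V t = (‖V t‖ : ℂ) * exp (((B t + Real.pi / 2 : ℝ) : ℂ) * I) := by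
    intro t hs
    refine ⟨fun h0 => slitPlane_ne_zero hs (by simp [h0]), ?_⟩
    have := norm_mul_exp_arg_mul_I (-I * V t)
    rw [norm_mul, norm_neg, norm_I, one_mul] at this
    have hk : exp (((Real.pi / 2 : ℝ) : ℂ) * I) = I := by
      push_cast; exact exp_pi_div_two_mul_I
    rw [ofReal_add, add_mul, exp_add, hk, ← mul_assoc, this]
    linear_combination (V t) * I_mul_I
  have k1 : exp (((-(Real.pi / 2) : ℝ) : ℂ) * I) = -I := by
    push_cast; rw [← neg_div]; exact exp_neg_pi_div_two_mul_I
  have k2 : exp (((3 * Real.pi / 2 : ℝ) : ℂ) * I) = -I := by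
    rw [← k1, exp_eq_exp_iff_exists_int]
    exact ⟨1, by push_cast; ring⟩
  have c1 : ∀ t ∈ Icc 0 (Real.pi / 2), 0 < Real.cos t ∨ t = Real.pi / 2 ∨ t = 3 * Real.pi / 2 := by
    rintro t ⟨h1, h2⟩
    rcases h2.eq_or_lt with h2 | h2
    · exact .inr (.inl h2)
    · exact .inl (Real.cos_pos_of_mem_Ioo ⟨by linarith, h2⟩)
  have c2 : ∀ t ∈ Icc (Real.pi / 2) (3 * Real.pi / 2),
      Real.cos t < 0 ∨ t = Real.pi / 2 ∨ t = 3 * Real.pi / 2 := by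
    rintro t ⟨h1, h2⟩
    rcases h1.eq_or_lt with h1 | h1
    · exact .inr (.inl h1.symm)
    rcases h2.eq_or_lt with h2 | h2
    · exact .inr (.inr h2)
    · exact .inl (Real.cos_neg_of_pi_div_two_lt_of_lt h1 (by linarith))
  have c3 : ∀ t ∈ Icc (3 * Real.pi / 2) (2 * Real.pi),
      0 < Real.cos t ∨ t = Real.pi / 2 ∨ t = 3 * Real.pi / 2 := by
    rintro t ⟨h1, h2⟩
    rcases h1.eq_or_lt with h1 | h1
    · exact .inr (.inr h1.symm)
    · left
      rw [← Real.cos_sub_two_pi]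
      exact Real.cos_pos_of_mem_Ioo ⟨by linarith, by linarith⟩
  set θ : ℝ → ℝ := fun t => if t ≤ Real.pi / 2 then A t + -(Real.pi / 2) else
    if t ≤ 3 * Real.pi / 2 then B t + Real.pi / 2 else A t + 3 * Real.pi / 2 with hθ
  have θ1 : ∀ t ∈ Icc 0 (Real.pi / 2), θ t = A t + -(Real.pi / 2) := fun t h => if_pos h.2
  have θ2 : ∀ t ∈ Icc (Real.pi / 2) (3 * Real.pi / 2), θ t = B t + Real.pi / 2 := by
    rintro t ⟨h1, h2⟩
    rcases h1.eq_or_lt with h1 | h1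
    · rw [hθ, ← h1]; simp only [le_refl, if_true]; linarith
    · simp only [hθ, if_neg (not_le.2 h1), if_pos h2]
  have θ3 : ∀ t ∈ Icc (3 * Real.pi / 2) (2 * Real.pi), θ t = A t + 3 * Real.pi / 2 := by
    rintro t ⟨h1, h2⟩
    rcases h1.eq_or_lt with h1 | h1
    · rw [θ2 t ⟨by linarith, h1.symm.le⟩, ← h1]; exact hBA
    · simp only [hθ, if_neg (not_le.2 h1), if_neg (show ¬ t ≤ Real.pi / 2 by linarith)]
  have hunion : Icc 0 (2 * Real.pi) = Icc 0 (Real.pi / 2) ∪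
      (Icc (Real.pi / 2) (3 * Real.pi / 2) ∪ Icc (3 * Real.pi / 2) (2 * Real.pi)) := by
    rw [Icc_union_Icc_eq_Icc (by linarith) (by linarith),
      Icc_union_Icc_eq_Icc (by linarith) (by linarith)]
  have contA : ∀ t, I * V t ∈ slitPlane → ContinuousAt A t := fun t h =>
    (continuousAt_arg h).comp (f := fun t => I * V t) (by fun_prop)
  have contB : ∀ t, -I * V t ∈ slitPlane → ContinuousAt B t := fun t h =>
    (continuousAt_arg h).comp (f := fun t => -I * V t) (by fun_prop)
  refine ⟨θ, ?_, ?_, ?_⟩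
  · rw [hunion]
    refine ContinuousOn.union_of_isClosed ?_ (ContinuousOn.union_of_isClosed ?_ ?_ isClosed_Icc
      isClosed_Icc) isClosed_Icc (isClosed_Icc.union isClosed_Icc)
    · exact ContinuousOn.congr (fun t h =>
        ((contA t (slitA t (c1 t h))).add_const _).continuousWithinAt) θ1
    · exact ContinuousOn.congr (fun t h =>
        ((contB t (slitB t (c2 t h))).add_const _).continuousWithinAt) θ2
    · exact ContinuousOn.congr (fun t h =>
        ((contA t (slitA t (c3 t h))).add_const _).continuousWithinAt) θ3
  · intro t h
    rw [hunion] at h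
    rcases h with h | h | h
    · rw [θ1 t h]; exact polA t _ k1 (slitA t (c1 t h))
    · rw [θ2 t h]; exact polB t (slitB t (c2 t h))
    · rw [θ3 t h]; exact polA t _ k2 (slitA t (c3 t h))
  · rw [θ1 0 ⟨le_rfl, by linarith⟩, θ3 _ ⟨by linarith, le_rfl⟩]
    simp only [A, hper]
    ring

/-- A planar vector field whose first component is positive above and negative below the origin,
and whose second component, at zeros of the first one, has the sign opposite to that of the
abscissa, has index one at the origin. -/
theorem hasVectorFieldIndex_one {V : ℂ → ℂ} {R : ℝ} (hR : 0 < R)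
    (hV : ContinuousOn V (Metric.ball 0 R))
    (hr : ∀ z ∈ Metric.ball (0 : ℂ) R, 0 < z.re → (V z).re = 0 → (V z).im < 0)
    (hl : ∀ z ∈ Metric.ball (0 : ℂ) R, z.re < 0 → (V z).re = 0 → 0 < (V z).im)
    (ht : ∀ z ∈ Metric.ball (0 : ℂ) R, z.re = 0 → 0 < z.im → 0 < (V z).re)
    (hb : ∀ z ∈ Metric.ball (0 : ℂ) R, z.re = 0 → z.im < 0 → (V z).re < 0) :
    HasVectorFieldIndex V 0 1 := by
  refine ⟨R, hR, fun r hrI => ?_⟩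
  have hmem : ∀ t, circleMap 0 r t ∈ Metric.ball (0 : ℂ) R := fun t => by
    simp [abs_of_pos hrI.1, hrI.2]
  have hre : ∀ t, (circleMap 0 r t).re = r * Real.cos t := fun t => by
    simp [circleMap, Complex.exp_ofReal_mul_I_re]
  have him : ∀ t, (circleMap 0 r t).im = r * Real.sin t := fun t => by
    simp [circleMap, Complex.exp_ofReal_mul_I_im]
  have e : 3 * Real.pi / 2 = Real.pi / 2 + Real.pi := by ring
  obtain ⟨θ, h1, h2, h3⟩ := exists_argument_of_axis_crossings
    (V := fun t => V (circleMap 0 r t))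
    (hV.comp_continuous (continuous_circleMap 0 r) hmem)
    (by simp [circleMap])
    (fun t h => hr _ (hmem t) (by rw [hre]; exact mul_pos hrI.1 h))
    (fun t h => hl _ (hmem t) (by rw [hre]; exact mul_neg_of_pos_of_neg hrI.1 h))
    (ht _ (hmem _) (by simp [hre]) (by simp [him, hrI.1]))
    (hb _ (hmem _) (by simp [hre, e, Real.cos_add_pi]) (by simp [him, e, Real.sin_add_pi, hrI.1]))
  exact ⟨θ, h1, h2, by simpa using h3⟩

/-- Conjugation negates arguments. This reduces index -1 to the index one criterion. -/
theorem HasVectorFieldIndex.of_conj {V : ℂ → ℂ} {z₀ : ℂ} {n : ℤ}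
    (h : HasVectorFieldIndex (fun z => starRingEnd ℂ (V z)) z₀ n) :
    HasVectorFieldIndex V z₀ (-n) := by
  obtain ⟨R, hR, h⟩ := h
  refine ⟨R, hR, fun r hr => ?_⟩
  obtain ⟨θ, h1, h2, h3⟩ := h r hr
  refine ⟨fun t => -θ t, h1.neg, fun t ht => ?_, ?_⟩
  · obtain ⟨h4, h5⟩ := h2 t ht
    refine ⟨by simpa using h4, ?_⟩
    have := congrArg (starRingEnd ℂ) h5
    simpa [← Complex.exp_conj] using this
  · push_cast; linarith

/-! ### Supporting lines: from the convex domain to the oval -/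

/-- A linear form on the plane vanishing on the unit vector `v` is a multiple of `cross v`. -/
theorem exists_eq_mul_cross {v : Plane} (hv : ‖v‖ = 1) (f : Plane →L[ℝ] ℝ) (hf : f v = 0) :
    ∃ μ : ℝ, ∀ u, f u = μ * cross v u := by
  have hlin : ∀ u : Plane, f u = u 0 * f (EuclideanSpace.single 0 1) +
      u 1 * f (EuclideanSpace.single 1 1) := by
    intro u
    have : u = u 0 • EuclideanSpace.single (0 : Fin 2) (1 : ℝ) +
        u 1 • EuclideanSpace.single (1 : Fin 2) (1 : ℝ) := by
      ext i; fin_cases i <;> simp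
    conv_lhs => rw [this, map_add, map_smul, map_smul]
    rfl
  set α := f (EuclideanSpace.single 0 1)
  set β := f (EuclideanSpace.single 1 1)
  have h1 : v 0 ^ 2 + v 1 ^ 2 = 1 := by rw [← norm_sq_plane, hv, one_pow]
  rw [hlin] at hf
  refine ⟨v 0 * β - v 1 * α, fun u => ?_⟩
  rw [hlin, cross]
  linear_combination (-(u 0 * α) - u 1 * β) * h1 + (u 0 * v 0 + u 1 * v 1) * hf

theorem ext_inner_cross {v a b : Plane} (hv : ‖v‖ = 1) (h1 : ⟪v, a⟫ = ⟪v, b⟫)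
    (h2 : cross v a = cross v b) : a = b := by
  have h3 : v 0 ^ 2 + v 1 ^ 2 = 1 := by rw [← norm_sq_plane, hv, one_pow]
  rw [inner_plane, inner_plane] at h1
  rw [cross, cross] at h2
  ext i
  fin_cases i <;> simp only [Fin.mk_zero, Fin.mk_one, Fin.isValue]
  · linear_combination (b 0 - a 0) * h3 + v 0 * h1 - v 1 * h2
  · linear_combination (b 1 - a 1) * h3 + v 1 * h1 + v 0 * h2

theorem inner_reflection_span {v : Plane} (hv : ‖v‖ = 1) (w : Plane) :
    ⟪v, (Submodule.span ℝ {v}).reflection w⟫ = ⟪v, w⟫ := by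
  rw [Submodule.reflection_singleton_apply]
  simp only [hv, inner_sub_right, two_smul, inner_add_right, real_inner_smul_right,
    real_inner_self_eq_norm_sq]
  simp

theorem cross_reflection_span {v : Plane} (hv : ‖v‖ = 1) (w : Plane) :
    cross v ((Submodule.span ℝ {v}).reflection w) = -cross v w := by
  rw [Submodule.reflection_singleton_apply]
  simp [hv, cross]
  ring

theorem exists_lift {L : ℝ} (hL : 0 < L) (x : ℝ) (ξ : AddCircle L) :
    ∃ y ∈ Ico x (x + L), (y : AddCircle L) = ξ := by
  have : Fact (0 < L) := ⟨hL⟩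
  have := mem_univ ξ
  rwa [← AddCircle.coe_image_Ico_eq L x] at this

theorem coe_ne_coe {L x y : ℝ} (hL : 0 < L) (hx : x < y) (hy : y < x + L) :
    (y : AddCircle L) ≠ (x : AddCircle L) := by
  have : Fact (0 < L) := ⟨hL⟩
  intro h
  rw [AddCircle.coe_eq_coe_iff_of_mem_Ico (a := x) ⟨hx.le, hy⟩ ⟨le_rfl, by linarith⟩] at h
  exact hx.ne' h

theorem mul_pos_of_continuous_of_ne_zero {f : ℝ → ℝ} (hf : Continuous f) (h0 : ∀ x, f x ≠ 0)
    (x y : ℝ) : 0 < f x * f y := by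
  by_contra! h
  have hxy : ∃ z, f z = 0 := by
    rcases mul_nonpos_iff.1 h with h | h
    · exact (isPreconnected_univ.intermediate_value (mem_univ y) (mem_univ x) hf.continuousOn
        ⟨h.2, h.1⟩).imp fun z hz => hz.2
    · exact (isPreconnected_univ.intermediate_value (mem_univ x) (mem_univ y) hf.continuousOn
        ⟨h.1, h.2⟩).imp fun z hz => hz.2
  exact h0 _ hxy.choose_spec

/-- A functional attaining its supremum over a strictly convex domain at a boundary point is
strictly smaller at every other boundary point. -/
theorem exists_strict_supporting {Ω : Set Plane} (hopen : IsOpen Ω) (hconv : Convex ℝ Ω)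
    (hstrict : StrictConvex ℝ (closure Ω)) (hne : Ω.Nonempty) {a : Plane} (ha : a ∈ frontier Ω) :
    ∃ f : Plane →L[ℝ] ℝ, (∀ b ∈ Ω, f b < f a) ∧ ∀ b ∈ frontier Ω, b ≠ a → f b < f a := by
  have haΩ : a ∉ Ω := by rw [hopen.frontier_eq] at ha; exact ha.2
  obtain ⟨f, hf⟩ := geometric_hahn_banach_open_point hconv hopen haΩ
  refine ⟨f, hf, fun b hb hba => ?_⟩
  -- The midpoint of `a` and `b` lies in `Ω`, where `f` is already strictly below `f a`.
  have hmid := hstrict (frontier_subset_closure hb) (frontier_subset_closure ha) hba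
    (show (0 : ℝ) < 1 / 2 by norm_num) (show (0 : ℝ) < 1 / 2 by norm_num) (by norm_num)
  rw [hconv.interior_closure_eq_interior_of_nonempty_interior (by rwa [hopen.interior_eq]),
    hopen.interior_eq] at hmid
  have := hf _ hmid
  rw [map_add, map_smul, map_smul, smul_eq_mul, smul_eq_mul] at this
  linarith

/-- A supporting functional at `c x` is maximal there along the curve, so it kills the velocity and
is a multiple of the determinant with it. Its strict inequalities give `center`. -/
theorem IsAnalyticUnitSpeedParam.isOval {Ω : Set Plane} (hopen : IsOpen Ω) (hconv : Convex ℝ Ω)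
    (hstrict : StrictConvex ℝ (closure Ω)) (hcenter : (0 : Plane) ∈ Ω) {L : ℝ} (hL : 0 < L)
    {γ : AddCircle L → Plane} (hγ : IsAnalyticUnitSpeedParam Ω γ) :
    IsOval (fun t : ℝ => γ (t : AddCircle L)) L := by
  set c : ℝ → Plane := fun t => γ (t : AddCircle L)
  have hc : ContDiff ℝ ω c := contDiff_omega_iff_analyticOnNhd.2 hγ.analytic
  have hd : Continuous (deriv c) := hc.continuous_deriv (by simp)
  have hfr : ∀ x, c x ∈ frontier Ω := fun x => hγ.range_eq ▸ mem_range_self _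
  have hper : ∀ t, c (t + L) = c t := fun t => by simp [c]
  have key : ∀ x, ∃ μ : ℝ, 0 < μ * cross (deriv c x) (c x) ∧
      ∀ y : ℝ, (y : AddCircle L) ≠ x → μ * cross (deriv c x) (c y - c x) < 0 := by
    intro x
    obtain ⟨f, hf, hf'⟩ := exists_strict_supporting hopen hconv hstrict ⟨0, hcenter⟩ (hfr x)
    have hmax : IsLocalMax (fun t => f (c t)) x := by
      refine .of_forall fun t => ?_
      by_cases h : c t = c x
      · simp [h]
      · exact (hf' _ (hfr t) h).le
    have hder : HasDerivAt (fun t => f (c t)) (f (deriv c x)) x :=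
      f.hasFDerivAt.comp_hasDerivAt x (hc.differentiable (by simp) x).hasDerivAt
    obtain ⟨μ, hμ⟩ := exists_eq_mul_cross (hγ.unit_speed x) f (hmax.hasDerivAt_eq_zero hder)
    refine ⟨μ, ?_, fun y hy => ?_⟩
    · rw [← hμ]; simpa using hf 0 hcenter
    · rw [← hμ, map_sub]
      linarith [hf' _ (hfr y) fun h => hy (hγ.injective h)]
  have hcenter' : ∀ x y : ℝ, (y : AddCircle L) ≠ x →
      cross (deriv c x) (c x) * cross (deriv c x) (c y - c x) < 0 := by
    intro x y hy
    obtain ⟨μ, h1, h2⟩ := key x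
    have h3 := mul_neg_of_pos_of_neg h1 (h2 y hy)
    have h4 : 0 ≤ μ * μ := mul_self_nonneg μ
    by_contra! h5
    nlinarith
  -- The orientation about the origin is the same at all points; dividing it out of the product of
  -- two `center` inequalities leaves `turning`.
  have hsign := mul_pos_of_continuous_of_ne_zero (f := fun x => cross (deriv c x) (c x))
    (by have := hc.continuous; unfold cross; fun_prop) fun x h0 => by
      obtain ⟨μ, h1, -⟩ := key x
      rw [h0, mul_zero] at h1
      exact h1.false
  refine ⟨hL, hc, hγ.unit_speed, hper, fun x y h1 h2 => ?_,
    fun x y h1 h2 => hcenter' x y (coe_ne_coe hL h1 h2)⟩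
  have hyx := coe_ne_coe hL h1 h2
  have e1 := hcenter' x y hyx
  have e2 := hcenter' y x hyx.symm
  have e3 := hsign x y
  have e4 := mul_pos_of_neg_of_neg e1 e2
  have e5 : 0 < (cross (deriv c x) (c x) * cross (deriv c y) (c y)) *
      (cross (deriv c x) (c y - c x) * cross (deriv c y) (c x - c y)) := by linarith
  exact (pos_iff_pos_of_mul_pos e5).1 e3

theorem velocity_coe {L : ℝ} (γ : AddCircle L → Plane) (x : ℝ) :
    velocity γ (x : AddCircle L) = deriv (fun t : ℝ => γ (t : AddCircle L)) x := by
  have := deriv_comp_const_add (f := fun t : ℝ => γ (t : AddCircle L)) x 0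
  simpa [velocity] using this

/-! ### Reflected rays and critical points on the torus -/

section Circle

variable {L : ℝ} {γ : AddCircle L → Plane} {g : ℝ → ℝ}

/-- Vanishing of ∂₁Ψ equates the tangential components of the incoming and outgoing unit vectors.
Their normal components then agree up to sign, and `center` selects the reflected sign. -/
theorem reflectsTo_bounce (h : IsOval (fun t : ℝ => γ (t : AddCircle L)) L)
    (hg : IsBounce (fun t : ℝ => γ (t : AddCircle L)) L g) (x : ℝ) :
    ReflectsTo γ (x : AddCircle L) (g x : AddCircle L) := by
  have h0 := hg.eq_zero x
  have hne := hg.sub_ne_zero h x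
  have hcen := h.center x _ (hg.mem x).1 (hg.mem x).2
  have hw0 := h.ne_zero x
  have hv := h.speed x
  rw [perimeterDeriv, norm_sub_rev, real_inner_smul_right, real_inner_smul_right,
    ← neg_sub (γ (g x : AddCircle L)), inner_neg_right, ← velocity_coe] at h0
  rw [← velocity_coe] at hv hcen
  unfold ReflectsTo
  set v := velocity γ (x : AddCircle L)
  set w := γ (x : AddCircle L)
  have hd0 : γ (g x : AddCircle L) - w ≠ 0 := by rwa [← neg_sub, neg_ne_zero]
  set d := γ (g x : AddCircle L) - w
  have hd : 0 < ‖d‖ := norm_pos_iff.2 hd0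
  have hw : 0 < ‖w‖ := norm_pos_iff.2 hw0
  have hin : ⟪v, d⟫ = ‖d‖ / ‖w‖ * ⟪v, w⟫ := by
    field_simp
    field_simp at h0
    linarith
  refine ⟨‖d‖ / ‖w‖, div_pos hd hw, ext_inner_cross hv ?_ ?_⟩
  · rw [real_inner_smul_right, inner_reflection_span hv, hin]
  · rw [cross_smul_right, cross_reflection_span hv]
    have e1 := cross_mul_cross v v d
    have e2 := cross_mul_cross v v w
    rw [real_inner_self_eq_norm_sq, hv] at e1 e2
    have hk : ‖d‖ = ‖d‖ / ‖w‖ * ‖w‖ := by field_simp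
    have hkpos : 0 < ‖d‖ / ‖w‖ := div_pos hd hw
    set k := ‖d‖ / ‖w‖
    have hsq : cross v d ^ 2 = (k * cross v w) ^ 2 := by
      rw [hin, hk] at e1
      linear_combination e1 - k ^ 2 * e2
    rcases sq_eq_sq_iff_eq_or_eq_neg.1 hsq with h1 | h1
    · rw [h1] at hcen
      nlinarith [mul_nonneg hkpos.le (mul_self_nonneg (cross v w))]
    · rw [h1]; ring

theorem eq_bounce_of_reflectsTo (h : IsOval (fun t : ℝ => γ (t : AddCircle L)) L)
    (hg : IsBounce (fun t : ℝ => γ (t : AddCircle L)) L g) {x : ℝ} {η : AddCircle L}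
    (hη : ReflectsTo γ (x : AddCircle L) η) : η = (g x : AddCircle L) := by
  obtain ⟨y, hy, rfl⟩ := exists_lift h.pos x η
  obtain ⟨t, ht, he⟩ := hη
  have hw : ‖γ (x : AddCircle L)‖ ≠ 0 := norm_ne_zero_iff.2 (h.ne_zero x)
  rcases hy.1.eq_or_lt with rfl | hxy
  · rw [sub_self, eq_comm, smul_eq_zero] at he
    rcases he with he | he
    · exact absurd he ht.ne'
    · rw [← norm_eq_zero, LinearIsometryEquiv.norm_map] at he
      exact absurd he hw
  · rw [hg.unique h ⟨hxy, hy.2⟩ ?_]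
    rw [perimeterDeriv, ← neg_sub (γ (y : AddCircle L)), norm_neg, he, norm_smul,
      LinearIsometryEquiv.norm_map, Real.norm_of_nonneg ht.le, ← velocity_coe]
    simp only [real_inner_smul_right, inner_neg_right, smul_neg]
    rw [inner_reflection_span (by rw [velocity_coe]; exact h.speed x)]
    field_simp
    ring

/-- Existence and uniqueness of the reflected point make the choice in `nextParam` immaterial. -/
theorem phi_coe (h : IsOval (fun t : ℝ => γ (t : AddCircle L)) L)
    (hg : IsBounce (fun t : ℝ => γ (t : AddCircle L)) L g) (x : ℝ) :
    phi γ (x : AddCircle L) = perimeter (fun t : ℝ => γ (t : AddCircle L)) x (g x) := by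
  have hex : ∃ η, ReflectsTo γ (x : AddCircle L) η := ⟨_, reflectsTo_bounce h hg x⟩
  rw [phi, nextParam, dif_pos hex, eq_bounce_of_reflectsTo h hg hex.choose_spec]
  rfl

theorem inChart_Psi (x y : ℝ) (z : ℂ) :
    inChart (Psi γ) ((x : AddCircle L), (y : AddCircle L)) z =
      perimeter (fun t : ℝ => γ (t : AddCircle L)) (x + z.re) (y + z.im) := rfl

theorem hasGradientAt_inChart_Psi (h : IsOval (fun t : ℝ => γ (t : AddCircle L)) L) {x y : ℝ}
    {z : ℂ} (hne : γ ((x + z.re : ℝ) : AddCircle L) - γ ((y + z.im : ℝ) : AddCircle L) ≠ 0) :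
    HasGradientAt (inChart (Psi γ) ((x : AddCircle L), (y : AddCircle L)))
      ⟨perimeterDeriv (fun t : ℝ => γ (t : AddCircle L)) (x + z.re) (y + z.im),
        perimeterDeriv (fun t : ℝ => γ (t : AddCircle L)) (y + z.im) (x + z.re)⟩ z := by
  rw [hasGradientAt_iff_hasFDerivAt]
  have h1 : HasFDerivAt (fun z : ℂ => (x + z.re, y + z.im))
      (Complex.reCLM.prod Complex.imCLM) z :=
    (Complex.reCLM.hasFDerivAt.const_add x).prodMk (Complex.imCLM.hasFDerivAt.const_add y)
  have h2 := (h.hasFDerivAt_perimeter hne).comp (f := fun z : ℂ => (x + z.re, y + z.im)) z h1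
  refine h2.congr_fderiv ?_
  ext w
  simp [Complex.inner, mul_comm]

theorem isCriticalPt_Psi_iff (h : IsOval (fun t : ℝ => γ (t : AddCircle L)) L) {x y : ℝ}
    (hx : x < y) (hy : y < x + L) :
    IsCriticalPt (Psi γ) ((x : AddCircle L), (y : AddCircle L)) ↔
      perimeterDeriv (fun t : ℝ => γ (t : AddCircle L)) x y = 0 ∧
      perimeterDeriv (fun t : ℝ => γ (t : AddCircle L)) y x = 0 := by
  have key := hasGradientAt_inChart_Psi (z := 0) (x := x) (y := y) h
    (by simpa using h.sub_ne_zero hx hy)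
  simp only [Complex.zero_re, Complex.zero_im, add_zero] at key
  rw [IsCriticalPt]
  constructor
  · intro h0
    have := key.unique h0
    exact ⟨congrArg Complex.re this, congrArg Complex.im this⟩
  · rintro ⟨h1, h2⟩
    rw [h1, h2] at key
    exact key

/-- With the first parameter fixed, removing the smooth terms leaves the chord length `‖c (x + t) -
c x‖`. Were it differentiable at its minimum `t = 0`, the speed there would be zero. -/
theorem not_isCriticalPt_Psi_diag (h : IsOval (fun t : ℝ => γ (t : AddCircle L)) L) (x : ℝ) :
    ¬ IsCriticalPt (Psi γ) ((x : AddCircle L), (x : AddCircle L)) := by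
  intro h0
  rw [IsCriticalPt, hasGradientAt_iff_hasFDerivAt, map_zero] at h0
  have h1 : HasDerivAt (fun t : ℝ => inChart (Psi γ) ((x : AddCircle L), (x : AddCircle L))
      (t * Complex.I)) _ 0 :=
    HasFDerivAt.comp_hasDerivAt_of_eq (f := fun t : ℝ => (t : ℂ) * Complex.I) (0 : ℝ) h0
      ((Complex.ofRealCLM.hasDerivAt (x := (0 : ℝ))).mul_const Complex.I) (by simp)
  simp only [inChart_Psi, Complex.re_ofReal_mul, Complex.im_ofReal_mul, Complex.I_re,
    Complex.I_im, mul_zero, mul_one, add_zero, perimeter] at h1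
  set c : ℝ → Plane := fun t : ℝ => γ (t : AddCircle L) with hcdef
  have hc : HasDerivAt (fun t : ℝ => c (x + t)) (deriv c x) 0 := by
    have := h.hasDerivAt (x + 0)
    rw [add_zero] at this
    exact HasDerivAt.comp_const_add x 0 (by simpa using this)
  have h2 := hasDerivAt_norm_curve hc (by simpa using h.ne_zero x)
  have h3 := ((h1.sub h2).sub_const ‖c x‖).congr_of_eventuallyEq
    (f₁ := fun t => ‖c (x + t) - c x‖) (.of_forall fun t => by simp [hcdef]; ring)
  have hmin : IsLocalMin (fun t => ‖c (x + t) - c x‖) 0 := .of_forall fun t => by simp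
  rw [hmin.hasDerivAt_eq_zero h3] at h3
  have h4 : HasDerivAt (fun t => c (x + t)) 0 0 := by
    rw [hasDerivAt_iff_isLittleO] at h3 ⊢
    simp only [add_zero, sub_self, norm_zero, sub_zero, smul_zero] at h3 ⊢
    exact h3.of_norm_left
  have := h.speed x
  rw [hc.unique h4, norm_zero] at this
  exact zero_ne_one this

/-- A critical point of the perimeter has a lift on the graph of the reflection map. -/
theorem exists_lift_of_isCriticalPt (h : IsOval (fun t : ℝ => γ (t : AddCircle L)) L)
    (hg : IsBounce (fun t : ℝ => γ (t : AddCircle L)) L g) {p : AddCircle L × AddCircle L}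
    (hp : IsCriticalPt (Psi γ) p) :
    ∃ x : ℝ, p = ((x : AddCircle L), (g x : AddCircle L)) := by
  obtain ⟨ξ, η⟩ := p
  obtain ⟨x, -, rfl⟩ := exists_lift h.pos 0 ξ
  obtain ⟨y, hy, rfl⟩ := exists_lift h.pos x η
  rcases hy.1.eq_or_lt with rfl | hxy
  · exact absurd hp (not_isCriticalPt_Psi_diag h x)
  · exact ⟨x, by rw [hg.unique h ⟨hxy, hy.2⟩ ((isCriticalPt_Psi_iff h hxy hy.2).1 hp).1]⟩

theorem isCriticalPt_bounce_iff (h : IsOval (fun t : ℝ => γ (t : AddCircle L)) L)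
    (hg : IsBounce (fun t : ℝ => γ (t : AddCircle L)) L g) (x : ℝ) :
    IsCriticalPt (Psi γ) ((x : AddCircle L), (g x : AddCircle L)) ↔
      perimeterDeriv (fun t : ℝ => γ (t : AddCircle L)) (g x) x = 0 := by
  rw [isCriticalPt_Psi_iff h (hg.mem x).1 (hg.mem x).2]
  exact and_iff_right (hg.eq_zero x)

theorem nhds_coe_prod (x y : ℝ) :
    𝓝 ((x : AddCircle L), (y : AddCircle L)) =
      map (Prod.map ((↑) : ℝ → AddCircle L) ((↑) : ℝ → AddCircle L)) (𝓝 (x, y)) :=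
  ((QuotientAddGroup.isOpenQuotientMap_mk.prodMap
    QuotientAddGroup.isOpenQuotientMap_mk).map_nhds_eq (x, y)).symm

/-- Nearby critical points lie on the graph of `g`, over zeros of the residual. -/
theorem isIsolatedCriticalPt_bounce (h : IsOval (fun t : ℝ => γ (t : AddCircle L)) L)
    (hg : IsBounce (fun t : ℝ => γ (t : AddCircle L)) L g) {x : ℝ}
    (h0 : perimeterDeriv (fun t : ℝ => γ (t : AddCircle L)) (g x) x = 0)
    (hiso : ∀ᶠ s in 𝓝[≠] x, perimeterDeriv (fun t : ℝ => γ (t : AddCircle L)) (g s) s ≠ 0) :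
    IsIsolatedCriticalPt (Psi γ) ((x : AddCircle L), (g x : AddCircle L)) := by
  refine ⟨(isCriticalPt_bounce_iff h hg x).2 h0, ?_⟩
  rw [eventually_nhdsWithin_iff, nhds_coe_prod, eventually_map]
  rw [eventually_nhdsWithin_iff] at hiso
  have e1 : ∀ᶠ q : ℝ × ℝ in 𝓝 (x, g x), q.1 < q.2 :=
    continuousAt_fst.eventually_lt continuousAt_snd (hg.mem x).1
  have e2 : ∀ᶠ q : ℝ × ℝ in 𝓝 (x, g x), q.2 < q.1 + L :=
    continuousAt_snd.eventually_lt (continuousAt_fst.add continuousAt_const) (hg.mem x).2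
  have e3 := (continuousAt_fst (p := (x, g x))).eventually hiso
  filter_upwards [e1, e2, e3] with q h1 h2 h3 hq hcrit
  obtain ⟨h4, h5⟩ := (isCriticalPt_Psi_iff h h1 h2).1 hcrit
  have hq2 := hg.unique h ⟨h1, h2⟩ h4
  by_cases hqx : q.1 = x
  · apply hq
    exact Prod.ext (by simp [hqx]) (by simp [hq2, hqx])
  · exact h3 hqx (hq2 ▸ h5)

/-- The whole graph of `g` is critical and accumulates at each of its points. -/
theorem not_isIsolatedCriticalPt (h : IsOval (fun t : ℝ => γ (t : AddCircle L)) L)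
    (hg : IsBounce (fun t : ℝ => γ (t : AddCircle L)) L g)
    (h0 : ∀ x, perimeterDeriv (fun t : ℝ => γ (t : AddCircle L)) (g x) x = 0)
    (p : AddCircle L × AddCircle L) : ¬ IsIsolatedCriticalPt (Psi γ) p := by
  rintro ⟨hp, hiso⟩
  obtain ⟨x, rfl⟩ := exists_lift_of_isCriticalPt h hg hp
  have hL := h.pos
  have ht : Tendsto (fun s : ℝ => ((s : AddCircle L), (g s : AddCircle L))) (𝓝[>] x)
      (𝓝[≠] ((x : AddCircle L), (g x : AddCircle L))) := by
    refine tendsto_nhdsWithin_iff.2 ⟨?_, ?_⟩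
    · have hc : Continuous fun s : ℝ => ((s : AddCircle L), (g s : AddCircle L)) :=
        (AddCircle.continuous_mk' L).prodMk
          ((AddCircle.continuous_mk' L).comp (hg.contDiff h).continuous)
      exact hc.continuousAt.tendsto.mono_left nhdsWithin_le_nhds
    · filter_upwards [Ioo_mem_nhdsGT (show x < x + L by linarith)] with s hs heq
      exact coe_ne_coe hL hs.1 hs.2 (congrArg Prod.fst heq)
  obtain ⟨s, hs⟩ := (ht.eventually hiso).exists
  exact hs ((isCriticalPt_bounce_iff h hg s).2 (h0 s))

end Circle

/-! ### Index of the gradient at points of the graph, and the maximum -/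

section Circle

variable {L : ℝ} {γ : AddCircle L → Plane} {g : ℝ → ℝ}

/-- Near a point of the graph of the reflection map, the gradient of the perimeter is given by the
partial derivatives of the lift. -/
theorem exists_ball_gradient (h : IsOval (fun t : ℝ => γ (t : AddCircle L)) L)
    (hg : IsBounce (fun t : ℝ => γ (t : AddCircle L)) L g) (x : ℝ) {P : ℂ → Prop}
    (hP : ∀ᶠ z in 𝓝 0, P z) :
    ∃ R > 0, ∀ z ∈ Metric.ball (0 : ℂ) R, P z ∧
      x + z.re < g x + z.im ∧ g x + z.im < x + z.re + L ∧
      x < g x + z.im ∧ g x + z.im < x + L ∧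
      gradient (inChart (Psi γ) ((x : AddCircle L), (g x : AddCircle L))) z =
        ⟨perimeterDeriv (fun t : ℝ => γ (t : AddCircle L)) (x + z.re) (g x + z.im),
          perimeterDeriv (fun t : ℝ => γ (t : AddCircle L)) (g x + z.im) (x + z.re)⟩ := by
  have hx := hg.mem x
  have c1 : Continuous fun z : ℂ => x + z.re := by fun_prop
  have c2 : Continuous fun z : ℂ => g x + z.im := by fun_prop
  have e1 : ∀ᶠ z : ℂ in 𝓝 0, x + z.re < g x + z.im :=
    c1.continuousAt.eventually_lt c2.continuousAt (by simpa using hx.1)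
  have e2 : ∀ᶠ z : ℂ in 𝓝 0, g x + z.im < x + z.re + L :=
    c2.continuousAt.eventually_lt (c1.add continuous_const).continuousAt (by simpa using hx.2)
  have e3 : ∀ᶠ z : ℂ in 𝓝 0, x < g x + z.im :=
    continuousAt_const.eventually_lt c2.continuousAt (by simpa using hx.1)
  have e4 : ∀ᶠ z : ℂ in 𝓝 0, g x + z.im < x + L :=
    c2.continuousAt.eventually_lt continuousAt_const (by simpa using hx.2)
  obtain ⟨R, hR, hball⟩ := Metric.eventually_nhds_iff_ball.1
    (hP.and (e1.and (e2.and (e3.and e4))))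
  refine ⟨R, hR, fun z hz => ?_⟩
  obtain ⟨h0, h1, h2, h3, h4⟩ := hball z hz
  exact ⟨h0, h1, h2, h3, h4, (hasGradientAt_inChart_Psi h (h.sub_ne_zero h1 h2)).gradient⟩

theorem eventually_right_re {f : ℝ → Prop} {x : ℝ} (hf : ∀ᶠ s in 𝓝[>] x, f s) :
    ∀ᶠ z : ℂ in 𝓝 0, 0 < z.re → f (x + z.re) := by
  rw [eventually_nhdsWithin_iff] at hf
  have hc : Tendsto (fun z : ℂ => x + z.re) (𝓝 0) (𝓝 x) :=
    Continuous.tendsto' (by fun_prop) _ _ (by simp)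
  filter_upwards [hc.eventually hf] with z hz hz0
  exact hz (by simpa using hz0)

theorem eventually_left_re {f : ℝ → Prop} {x : ℝ} (hf : ∀ᶠ s in 𝓝[<] x, f s) :
    ∀ᶠ z : ℂ in 𝓝 0, z.re < 0 → f (x + z.re) := by
  rw [eventually_nhdsWithin_iff] at hf
  have hc : Tendsto (fun z : ℂ => x + z.re) (𝓝 0) (𝓝 x) :=
    Continuous.tendsto' (by fun_prop) _ _ (by simp)
  filter_upwards [hc.eventually hf] with z hz hz0
  exact hz (by simpa using hz0)

theorem continuousOn_gradient_ball (h : IsOval (fun t : ℝ => γ (t : AddCircle L)) L) {x y R : ℝ}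
    (hR : ∀ z ∈ Metric.ball (0 : ℂ) R, x + z.re < y + z.im ∧ y + z.im < x + z.re + L) :
    ContinuousOn (gradient (inChart (Psi γ) ((x : AddCircle L), (y : AddCircle L))))
      (Metric.ball 0 R) := by
  have key : ContinuousOn (fun z : ℂ =>
      ((perimeterDeriv (fun t : ℝ => γ (t : AddCircle L)) (x + z.re) (y + z.im) : ℝ) : ℂ) +
      ((perimeterDeriv (fun t : ℝ => γ (t : AddCircle L)) (y + z.im) (x + z.re) : ℝ) : ℂ) *
        Complex.I) (Metric.ball 0 R) := by
    intro z hz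
    have hne := h.sub_ne_zero (hR z hz).1 (hR z hz).2
    have hne' := hne
    rw [← neg_sub, neg_ne_zero] at hne'
    have c1 : ContinuousAt (fun z : ℂ => (x + z.re, y + z.im)) z := by fun_prop
    have c2 : ContinuousAt (fun z : ℂ => (y + z.im, x + z.re)) z := by fun_prop
    have d1 := (h.contDiffAt_perimeterDeriv hne).continuousAt.comp
      (f := fun z : ℂ => (x + z.re, y + z.im)) c1
    have d2 := (h.contDiffAt_perimeterDeriv hne').continuousAt.comp
      (f := fun z : ℂ => (y + z.im, x + z.re)) c2
    exact ((Complex.continuous_ofReal.continuousAt.comp d1).add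
      ((Complex.continuous_ofReal.continuousAt.comp d2).mul_const _)).continuousWithinAt
  refine key.congr fun z hz => ?_
  rw [(hasGradientAt_inChart_Psi h (h.sub_ne_zero (hR z hz).1 (hR z hz).2)).gradient]
  exact (Complex.mk_eq_add_mul_I _ _)

theorem perimeterDeriv_pos_above (h : IsOval (fun t : ℝ => γ (t : AddCircle L)) L)
    (hg : IsBounce (fun t : ℝ => γ (t : AddCircle L)) L g) {x y : ℝ} (hy : g x < y)
    (hy' : y < x + L) : 0 < perimeterDeriv (fun t : ℝ => γ (t : AddCircle L)) x y := by
  rw [← hg.eq_zero x]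
  exact h.strictMonoOn_perimeterDeriv x (hg.mem x) ⟨(hg.mem x).1.trans hy, hy'⟩ hy

theorem perimeterDeriv_neg_below (h : IsOval (fun t : ℝ => γ (t : AddCircle L)) L)
    (hg : IsBounce (fun t : ℝ => γ (t : AddCircle L)) L g) {x y : ℝ} (hy : y < g x)
    (hy' : x < y) : perimeterDeriv (fun t : ℝ => γ (t : AddCircle L)) x y < 0 := by
  rw [← hg.eq_zero x]
  exact h.strictMonoOn_perimeterDeriv x ⟨hy', hy.trans (hg.mem x).2⟩ (hg.mem x) hy

/-- The first component of the gradient vanishes only on the graph, where the second is the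
residual; on the vertical line through the point, monotonicity gives the sign of the first. -/
theorem hasCriticalIndex_one (h : IsOval (fun t : ℝ => γ (t : AddCircle L)) L)
    (hg : IsBounce (fun t : ℝ => γ (t : AddCircle L)) L g) {x : ℝ}
    (hl : ∀ᶠ s in 𝓝[<] x, 0 < perimeterDeriv (fun t : ℝ => γ (t : AddCircle L)) (g s) s)
    (hr : ∀ᶠ s in 𝓝[>] x, perimeterDeriv (fun t : ℝ => γ (t : AddCircle L)) (g s) s < 0) :
    HasCriticalIndex (Psi γ) ((x : AddCircle L), (g x : AddCircle L)) 1 := by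
  obtain ⟨R, hR, hb⟩ := exists_ball_gradient h hg x
    ((eventually_left_re hl).and (eventually_right_re hr))
  refine hasVectorFieldIndex_one hR
    (continuousOn_gradient_ball h fun z hz => ⟨(hb z hz).2.1, (hb z hz).2.2.1⟩) ?_ ?_ ?_ ?_
  all_goals
    intro z hz hz1 hz2
    obtain ⟨⟨h1, h2⟩, h3, h4, h5, h6, hgrad⟩ := hb z hz
    simp only [hgrad] at hz2 ⊢
  · rw [hg.unique h ⟨h3, h4⟩ hz2]; exact h2 hz1
  · rw [hg.unique h ⟨h3, h4⟩ hz2]; exact h1 hz1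
  · simp only [hz1, add_zero]
    exact perimeterDeriv_pos_above h hg (by linarith) h6
  · simp only [hz1, add_zero]
    exact perimeterDeriv_neg_below h hg (by linarith) h5

theorem hasCriticalIndex_neg_one (h : IsOval (fun t : ℝ => γ (t : AddCircle L)) L)
    (hg : IsBounce (fun t : ℝ => γ (t : AddCircle L)) L g) {x : ℝ}
    (hl : ∀ᶠ s in 𝓝[<] x, perimeterDeriv (fun t : ℝ => γ (t : AddCircle L)) (g s) s < 0)
    (hr : ∀ᶠ s in 𝓝[>] x, 0 < perimeterDeriv (fun t : ℝ => γ (t : AddCircle L)) (g s) s) :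
    HasCriticalIndex (Psi γ) ((x : AddCircle L), (g x : AddCircle L)) (-1) := by
  obtain ⟨R, hR, hb⟩ := exists_ball_gradient h hg x
    ((eventually_left_re hl).and (eventually_right_re hr))
  refine HasVectorFieldIndex.of_conj (hasVectorFieldIndex_one hR
    (Complex.continuous_conj.comp_continuousOn
      (continuousOn_gradient_ball h fun z hz => ⟨(hb z hz).2.1, (hb z hz).2.2.1⟩)) ?_ ?_ ?_ ?_)
  all_goals
    intro z hz hz1 hz2
    obtain ⟨⟨h1, h2⟩, h3, h4, h5, h6, hgrad⟩ := hb z hz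
    simp only [hgrad, Complex.conj_re, Complex.conj_im] at hz2 ⊢
  · rw [hg.unique h ⟨h3, h4⟩ hz2, neg_lt_zero]; exact h2 hz1
  · rw [hg.unique h ⟨h3, h4⟩ hz2, neg_pos]; exact h1 hz1
  · simp only [hz1, add_zero]
    exact perimeterDeriv_pos_above h hg (by linarith) h6
  · simp only [hz1, add_zero]
    exact perimeterDeriv_neg_below h hg (by linarith) h5

/-- The perimeter attains its maximum at a point of the graph of the reflection map. -/
theorem exists_max_bounce (h : IsOval (fun t : ℝ => γ (t : AddCircle L)) L)
    (hg : IsBounce (fun t : ℝ => γ (t : AddCircle L)) L g) :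
    ∃ x : ℝ, ∀ p, Psi γ p ≤ Psi γ ((x : AddCircle L), (g x : AddCircle L)) := by
  have hL := h.pos
  have : Fact (0 < L) := ⟨hL⟩
  have hγ : Continuous γ :=
    QuotientAddGroup.isOpenQuotientMap_mk.isQuotientMap.continuous_iff.2 h.smooth.continuous
  have hΨ : Continuous (Psi γ) := by unfold Psi; fun_prop
  obtain ⟨⟨ξ, η⟩, -, hmax⟩ := isCompact_univ.exists_isMaxOn univ_nonempty hΨ.continuousOn
  obtain ⟨x, -, rfl⟩ := exists_lift hL 0 ξ
  obtain ⟨y, hy, rfl⟩ := exists_lift hL x η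
  obtain ⟨y, hy, hmax⟩ : ∃ y ∈ Ioo x (x + L), ∀ p,
      Psi γ p ≤ Psi γ ((x : AddCircle L), (y : AddCircle L)) := by
    -- A maximum on the diagonal, where differentiability fails, can be moved off it: the triangle
    -- inequality shows that the perimeter does not decrease.
    rcases hy.1.eq_or_lt with rfl | hxy
    · refine ⟨x + L / 2, ⟨by linarith, by linarith⟩, fun p => (hmax (mem_univ p)).trans ?_⟩
      have := norm_sub_norm_le (γ (x : AddCircle L)) (γ ((x + L / 2 : ℝ) : AddCircle L))
      rw [norm_sub_rev] at this
      simp only [Psi, sub_self, norm_zero]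
      linarith
    · exact ⟨y, ⟨hxy, hy.2⟩, fun p => hmax (mem_univ p)⟩
  have hder := h.hasDerivAt_perimeter_left (h.sub_ne_zero hy.1 hy.2)
  have h0 := IsLocalMax.hasDerivAt_eq_zero
    (.of_forall fun s => hmax ((s : AddCircle L), (y : AddCircle L))) hder
  exact ⟨x, hg.unique h hy h0 ▸ hmax⟩

end Circle

/-! ### The dichotomy -/

theorem proposition3p5 (Ω : Set Plane) (hopen : IsOpen Ω) (hbdd : Bornology.IsBounded Ω)
    (hconv : Convex ℝ Ω) (hstrict : StrictConvex ℝ (closure Ω)) (hcenter : (0 : Plane) ∈ Ω)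
    (L : ℝ) (hL : 0 < L) (γ : AddCircle L → Plane) (hγ : IsAnalyticUnitSpeedParam Ω γ) :
    Xor (∃ C : ℝ, ∀ ξ : AddCircle L, phi γ ξ = C)
      (∃ p q : AddCircle L × AddCircle L,
        IsIsolatedCriticalPt (Psi γ) p ∧ IsIsolatedCriticalPt (Psi γ) q ∧
        GeometricallyDistinct p q ∧
        (∀ x : AddCircle L × AddCircle L, Psi γ x ≤ Psi γ p) ∧
        HasCriticalIndex (Psi γ) p 1 ∧
        ∃ n : ℤ, n < 0 ∧ HasCriticalIndex (Psi γ) q n) := by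
  have h := hγ.isOval hopen hconv hstrict hcenter hL
  choose g hmem hzero using h.exists_perimeterDeriv_eq_zero
  have hg : IsBounce (fun t : ℝ => γ (t : AddCircle L)) L g := ⟨hmem, hzero⟩
  by_cases hres : ∀ x, perimeterDeriv (fun t : ℝ => γ (t : AddCircle L)) (g x) x = 0
  · refine .inl ⟨⟨phi γ ((0 : ℝ) : AddCircle L), fun ξ => ?_⟩, ?_⟩
    · obtain ⟨x, -, rfl⟩ := exists_lift hL 0 ξ
      rw [phi_coe h hg, phi_coe h hg]
      exact hg.perimeter_const_of_residual_eq_zero h hres x 0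
    · rintro ⟨p, q, hp, -⟩
      exact not_isIsolatedCriticalPt h hg hres p hp
  · refine .inr ⟨?_, ?_⟩
    · obtain ⟨x₀, hx₀⟩ := not_forall.1 hres
      obtain ⟨x, hmax⟩ := exists_max_bounce h hg
      have hsign := fun (z : ℝ)
          (hz : ∀ p, Psi γ p ≤ Psi γ ((z : AddCircle L), (g z : AddCircle L))) =>
        hg.residual_sign_of_max h hx₀ (x := z) fun s t => hz (s, t)
      have hiso := hg.eventually_residual_ne_zero h hx₀
      obtain ⟨hl, hr⟩ := hsign x hmax
      obtain ⟨z, hzl, hzr⟩ := hg.exists_residual_sign_change h hl hr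
      have hz0 : perimeterDeriv (fun t : ℝ => γ (t : AddCircle L)) (g z) z = 0 := by
        have hc := (hg.contDiff_residual h).continuous.tendsto z
        exact le_antisymm
          (le_of_tendsto (hc.mono_left nhdsWithin_le_nhds) (hzl.mono fun s hs => hs.le))
          (ge_of_tendsto (hc.mono_left nhdsWithin_le_nhds) (hzr.mono fun s hs => hs.le))
      -- At a maximum the residual would be negative just to the right of `z`. The strict
      -- inequality, with the symmetry of Ψ, makes the two points geometrically distinct.
      have hlt : Psi γ ((z : AddCircle L), (g z : AddCircle L)) <
          Psi γ ((x : AddCircle L), (g x : AddCircle L)) := by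
        refine lt_of_le_of_ne (hmax _) fun heq => ?_
        obtain ⟨s, h1, h2⟩ := (hzr.and (hsign z (heq ▸ hmax)).2).exists
        exact lt_asymm h1 h2
      refine ⟨_, _, isIsolatedCriticalPt_bounce h hg
        (hg.residual_eq_zero_of_max h fun s t => hmax (s, t)) (hiso x),
        isIsolatedCriticalPt_bounce h hg hz0 (hiso z), ⟨?_, ?_⟩, hmax,
        hasCriticalIndex_one h hg hl hr, -1, by norm_num, hasCriticalIndex_neg_one h hg hzl hzr⟩
      · intro heq
        rw [heq] at hlt
        exact hlt.false
      · intro heq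
        rw [heq] at hlt
        refine hlt.ne ?_
        exact perimeter_comm (fun t : ℝ => γ (t : AddCircle L)) z (g z)
    · rintro ⟨C, hC⟩
      exact hres (hg.residual_eq_zero_of_perimeter_const h fun x => by rw [← phi_coe h hg, hC])
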